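/- Let $a>b>0$ and $\lambda\neq 0$ be real, $p^2=a^2+b^2$, $r^2=a^2-b^2$ ($p,r>0$). Consider the Kowalevski gyrostat in two constant fields $$2\dot\omega_1=\omega_2(\omega_3-\lambda)+\beta_3,\quad 2\dot\omega_2=-\omega_1(\omega_3-\lambda)-\alpha_3,\quad \dot\omega_3=\alpha_2-\beta_1,\quad \dot{\boldsymbol\alpha}=\boldsymbol\alpha\times\boldsymbol\omega,\quad \dot{\boldsymbol\beta}=\boldsymbol\beta\times\boldsymbol\omega$$ on the phase space $P^6=\{(\boldsymbol\omega,\boldsymbol\alpha,\boldsymbol\beta)\in(\mathbb R^3)^3:\ |\boldsymbol\alpha|^2=a^2,\ |\boldsymbol\beta|^2=b^2,\ \boldsymbol\alpha\cdot\boldsymbol\beta=0\}$, with the first integrals $$H=\omega_1^2+\omega_2^2+\tfrac12\omega_3^2-\alpha_1-\beta_2,$$ $$K=(\omega_1^2-\omega_2^2+\alpha_1-\beta_2)^2+(2\omega_1\omega_2+\alpha_2+\beta_1)^2+2\lambda[(\omega_3-\lambda)(\omega_1^2+\omega_2^2)+2\omega_1\alpha_3+2\omega_2\beta_3],$$ $$G=\tfrac14\big((\mathbf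 M\cdot\boldsymbol\alpha)^2+(\mathbf M\cdot\boldsymbol\beta)^2\big)+\tfrac12(\omega_3-\lambda)\,\mathbf M\cdot(\boldsymbol\alpha\times\boldsymbol\beta)-b^2\alpha_1-a^2\beta_2,\qquad \mathbf M=(2\omega_1,2\omega_2,\omega_3+\lambda).$$ Let $J=G\times K\times H:P^6\to\mathbb R^3$ and let $\mathfrak C_1$ be the set of critical points of $J$ at which $J$ has rank $1$. Differentials are restricted to the vectors tangent to $P^6$. Put $$x_{1,2}=(\alpha_1-\beta_2)\pm i(\alpha_2+\beta_1),\quad y_{1,2}=(\alpha_1+\beta_2)\pm i(\alpha_2-\beta_1),\quad z_{1,2}=\alpha_3\pm i\beta_3,\quad w_{1,2}=\omega_1\pm i\omega_2,\quad w_3=\omega_3 .$$ Then $\mathfrak C_1$ is exactly the set of points of $P^6$ where $\operatorname{rank}\{dK,dH\}=1$, and it is exactly the set of points of the following trajectories of the system. 1) The non-constant pendulum motions $$\boldsymbol\omega=\dot\varphi\,\mathbf e_3,\quad \boldsymbol\alpha=a(\mathbf e_1\cos\varphi-\mathbf e_2\sin\varphi),\quad \boldsymbol\beta=\pm b(\mathbf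 e_1\sin\varphi+\mathbf e_2\cos\varphi),\quad \ddot\varphi=-(a\pm b)\sin\varphi .$$ 2) The motions defined, with $w=w(t)>0$, by $$w_1=q\sqrt w,\quad w_2=\frac{\sqrt w}{q},\quad w_3=\frac\lambda\sigma w,$$ $$x_1=\frac{1}{\sigma u}\big[r^2\lambda^2\sigma^2-(\lambda^2+\sigma)u\,q^2w\big],\qquad x_2=\frac1{\sigma u}\Big[r^2\lambda^2\sigma^2-(\lambda^2+\sigma)u\frac{w}{q^2}\Big],$$ $$y_1=\sigma\Big(1+\frac{\sigma}{\lambda^2}-\frac{r^4\lambda^2\sigma}{u^2}\Big)+\frac{r^2\lambda^2}{u}q^2w,\qquad y_2=\sigma\Big(1+\frac{\sigma}{\lambda^2}-\frac{r^4\lambda^2\sigma}{u^2}\Big)+\frac{r^2\lambda^2}{u}\frac{w}{q^2},$$ $$z_1=-\frac{r^2\lambda\sigma}{u}\frac{\sqrt w}{q}+\frac{\lambda^2+\sigma}{\lambda}q\sqrt w,\qquad z_2=-\frac{r^2\lambda\sigma}{u}q\sqrt w+\frac{\lambda^2+\sigma}{\lambda}\frac{\sqrt w}{q}.$$ Here $q=q(w)\in\mathbb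 C$ is a root of $q^4-2Q(w)q^2+1=0$ with $$Q(w)=\frac{\sigma u^3+(\lambda^2+\sigma)[\lambda^2w^2+\sigma^2(2w-\sigma)]u^2+r^4\lambda^4\sigma^4}{2r^2\lambda^2\sigma^2(\lambda^2+\sigma)\,u\,w},$$ and $\sigma\ne0$, $u$ are real constants satisfying $$\lambda^2(\lambda^2+\sigma)^2u^5+(\lambda^2+\sigma)[2p^2\lambda^4-(\lambda^2+\sigma)^3\sigma]\sigma u^4+r^4\lambda^6\sigma^2u^3+2r^4\lambda^4\sigma^4(\lambda^2+\sigma)^2u^2-r^8\lambda^8\sigma^6=0$$ (hence $u\neq0$). The evolution $w(t)$ satisfies $$\Big(\frac{dw}{dt}\Big)^2=-\frac{\lambda^2}{4\sigma^2}P_+(w)P_-(w),$$ $$P_\pm(w)=w^2+2\sigma^2\frac{u\pm r^2\lambda^2}{\lambda^2u}w+\frac{\sigma[u^3-(\lambda^2+\sigma)\sigma^2u^2+r^4\lambda^4\sigma^3]}{(\lambda^2+\sigma)\lambda^2u^2}.$$ If $\sigma=-\lambda^2$, the expression $\dfrac{u^3+r^4\lambda^4\sigma^3}{\lambda^2+\sigma}$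 contained in $Q$ and $P_\pm$ has the form $0/0$, and it is understood as its limit along the relation between $\sigma$ and $u$, which is $2p^2\lambda^6u-r^4\lambda^8$. All pendulum motions are indeed trajectories of the system. Through every real point given by the formulas of 2), with some $w>0$ and with real $\sigma\ne0$, $u$ satisfying the relation, there passes a trajectory of type 2) with the same $\sigma,u$, defined for all $t\in\mathbb R$. Each of the trajectories 1) and 2) is non-constant and is either periodic or a separatrix, i.e. tends to one and the same equilibrium as $t\to+\infty$ and as $t\to-\infty$. -/

import Mathlib

open scoped Matrix Topology

noncomputable section

namespace KowalevskiGyrostat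

/-! ### Phase space, equations of motion and first integrals

Parameters: `a > b > 0` are the moduli of the two orthogonal field intensities, `lam` is the axial
component of the gyrostatic momentum. The components `1, 2, 3` of vectors of three-space are indexed
by `0, 1, 2`. -/

/-- A triple `(ω, α, β)`: the angular velocity and the intensities of the two fields. -/
abbrev State : Type := (Fin 3 → ℝ) × (Fin 3 → ℝ) × (Fin 3 → ℝ)

/-- The angular velocity `ω`. -/
def om (s : State) : Fin 3 → ℝ := s.1
/-- The intensity `α` of the first field. -/
def al (s : State) : Fin 3 → ℝ := s.2.1
/-- The intensity `β` of the second field. -/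
def be (s : State) : Fin 3 → ℝ := s.2.2

/-- The geometric integrals `(α · α, β · β, α · β)`. -/
def geom (s : State) : ℝ × ℝ × ℝ := (al s ⬝ᵥ al s, be s ⬝ᵥ be s, al s ⬝ᵥ be s)

/-- The six-dimensional phase space: `α · α = a ^ 2`, `β · β = b ^ 2`, `α · β = 0`. -/
def phaseSpace (a b : ℝ) : Set State := {s | geom s = (a ^ 2, b ^ 2, 0)}

/-- The tangent space at `s` of the level set of the geometric integrals through `s`. -/
def tangentSpace (s : State) : Submodule ℝ State :=
  LinearMap.ker (fderiv ℝ geom s).toLinearMap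

/-- The right-hand side of the equations of motion of the Kowalevski gyrostat
(inertia tensor `diag (2, 2, 1)`, gyrostatic momentum `(0, 0, lam)`) in two constant fields. -/
def field (lam : ℝ) (s : State) : State :=
  (![(om s 1 * (om s 2 - lam) + be s 2) / 2,
     (-(om s 0) * (om s 2 - lam) - al s 2) / 2,
     al s 1 - be s 0],
   al s ⨯₃ om s,
   be s ⨯₃ om s)

/-- A trajectory in the phase space, defined for all times. -/
def IsMotion (a b lam : ℝ) (γ : ℝ → State) : Prop :=
  (∀ t, γ t ∈ phaseSpace a b) ∧ ∀ t, HasDerivAt γ (field lam (γ t)) t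

/-- The equilibria in the phase space. -/
def IsEquilibrium (a b lam : ℝ) (s : State) : Prop :=
  s ∈ phaseSpace a b ∧ field lam s = 0

/-- The total angular momentum `I ω + (0, 0, lam)`. -/
def momentum (lam : ℝ) (s : State) : Fin 3 → ℝ :=
  ![2 * om s 0, 2 * om s 1, om s 2 + lam]

/-- The energy integral. -/
def H (s : State) : ℝ :=
  om s 0 ^ 2 + om s 1 ^ 2 + 1 / 2 * om s 2 ^ 2 - al s 0 - be s 1

/-- The generalized Kowalevski integral. -/
def K (lam : ℝ) (s : State) : ℝ :=
  (om s 0 ^ 2 - om s 1 ^ 2 + al s 0 - be s 1) ^ 2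
    + (2 * om s 0 * om s 1 + al s 1 + be s 0) ^ 2
    + 2 * lam * ((om s 2 - lam) * (om s 0 ^ 2 + om s 1 ^ 2)
        + 2 * om s 0 * al s 2 + 2 * om s 1 * be s 2)

/-- The third integral, of Reyman and Semenov-Tian-Shansky. -/
def G (a b lam : ℝ) (s : State) : ℝ :=
  1 / 4 * ((momentum lam s ⬝ᵥ al s) ^ 2 + (momentum lam s ⬝ᵥ be s) ^ 2)
    + 1 / 2 * (om s 2 - lam) * (momentum lam s ⬝ᵥ (al s ⨯₃ be s))
    - b ^ 2 * al s 0 - a ^ 2 * be s 1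

/-! ### The momentum map and the strata of its critical set -/

/-- The momentum map `J = G × K × H`. -/
def J (a b lam : ℝ) (s : State) : ℝ × ℝ × ℝ := (G a b lam s, K lam s, H s)

/-- The rank at `s` of the restriction of the momentum map to the phase space. -/
def rankJ (a b lam : ℝ) (s : State) : ℕ :=
  Module.finrank ℝ
    (LinearMap.range ((fderiv ℝ (J a b lam) s).toLinearMap.domRestrict (tangentSpace s)))

/-- The set of critical points of the momentum map on the phase space. -/
def criticalSet (a b lam : ℝ) : Set State := {s ∈ phaseSpace a b | rankJ a b lam s < 3}

/-- The stratum of the critical set on which the momentum map has rank `j`. -/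
def stratum (a b lam : ℝ) (j : ℕ) : Set State := {s ∈ criticalSet a b lam | rankJ a b lam s = j}

/-- The differential of `f` at `s`, restricted to the vectors tangent to the phase space. -/
def dres (f : State → ℝ) (s : State) : Module.Dual ℝ (tangentSpace s) :=
  (fderiv ℝ f s).toLinearMap.domRestrict (tangentSpace s)

/-- The rank of the system of restricted differentials `{dK, dH}` at `s`. -/
def rankKH (lam : ℝ) (s : State) : ℕ :=
  Module.finrank ℝ (Submodule.span ℝ {dres (K lam) s, dres H s})

/-! ### Pendulum motions -/

/-- The motions of pendulum type about the third axis; `e = ±1`. -/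
def IsPendulumMotion (a b : ℝ) (γ : ℝ → State) : Prop :=
  ∃ (e : ℝ) (φ φ' : ℝ → ℝ), (e = 1 ∨ e = -1) ∧ ∀ t,
    HasDerivAt φ (φ' t) t ∧
    HasDerivAt φ' (-(a + e * b) * Real.sin (φ t)) t ∧
    γ t = (![0, 0, φ' t],
           ![a * Real.cos (φ t), -(a * Real.sin (φ t)), 0],
           ![e * b * Real.sin (φ t), e * b * Real.cos (φ t), 0])

/-! ### Complex variables -/

/-- `x₁` -/
def x1 (s : State) : ℂ := ⟨al s 0 - be s 1, al s 1 + be s 0⟩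
/-- `x₂` -/
def x2 (s : State) : ℂ := ⟨al s 0 - be s 1, -(al s 1 + be s 0)⟩
/-- `y₁` -/
def y1 (s : State) : ℂ := ⟨al s 0 + be s 1, al s 1 - be s 0⟩
/-- `y₂` -/
def y2 (s : State) : ℂ := ⟨al s 0 + be s 1, -(al s 1 - be s 0)⟩
/-- `z₁` -/
def z1 (s : State) : ℂ := ⟨al s 2, be s 2⟩
/-- `z₂` -/
def z2 (s : State) : ℂ := ⟨al s 2, -(be s 2)⟩
/-- `w₁` -/
def w1 (s : State) : ℂ := ⟨om s 0, om s 1⟩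
/-- `w₂` -/
def w2 (s : State) : ℂ := ⟨om s 0, -(om s 1)⟩
/-- `w₃` -/
def w3 (s : State) : ℂ := (om s 2 : ℂ)

/-! ### The second family

Only even powers of `p = √(a ^ 2 + b ^ 2)` and `r = √(a ^ 2 - b ^ 2)` occur, so their squares `p2`
and `r2` are used. -/

/-- `p ^ 2` -/
def p2 (a b : ℝ) : ℝ := a ^ 2 + b ^ 2
/-- `r ^ 2` -/
def r2 (a b : ℝ) : ℝ := a ^ 2 - b ^ 2

/-- The quintic relation (of degree five in `u`) between the constants `σ` and `u`. -/
def Quintic (a b lam σ u : ℝ) : Prop :=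
  lam ^ 2 * (lam ^ 2 + σ) ^ 2 * u ^ 5
    + (lam ^ 2 + σ) * (2 * p2 a b * lam ^ 4 - (lam ^ 2 + σ) ^ 3 * σ) * σ * u ^ 4
    + r2 a b ^ 2 * lam ^ 6 * σ ^ 2 * u ^ 3
    + 2 * r2 a b ^ 2 * lam ^ 4 * σ ^ 4 * (lam ^ 2 + σ) ^ 2 * u ^ 2
    - r2 a b ^ 4 * lam ^ 8 * σ ^ 6 = 0

open Classical in
/-- The function `Q(w)`. For `σ = -lam ^ 2` the general expression has the form `0 / 0`, and it is
replaced by its limit along the quintic relation. -/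
def Q (a b lam σ u w : ℝ) : ℝ :=
  if lam ^ 2 + σ = 0 then
    (σ * (2 * p2 a b * lam ^ 6 * u - r2 a b ^ 2 * lam ^ 8)
        + (lam ^ 2 * w ^ 2 + σ ^ 2 * (2 * w - σ)) * u ^ 2)
      / (2 * r2 a b * lam ^ 2 * σ ^ 2 * u * w)
  else
    (σ * u ^ 3 + (lam ^ 2 + σ) * (lam ^ 2 * w ^ 2 + σ ^ 2 * (2 * w - σ)) * u ^ 2
        + r2 a b ^ 2 * lam ^ 4 * σ ^ 4)
      / (2 * r2 a b * lam ^ 2 * σ ^ 2 * (lam ^ 2 + σ) * u * w)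

open Classical in
/-- The common constant term of the polynomials `P₊` and `P₋`, with the same convention for
`σ = -lam ^ 2`. -/
def Pconst (a b lam σ u : ℝ) : ℝ :=
  if lam ^ 2 + σ = 0 then
    σ * (2 * p2 a b * lam ^ 6 * u - r2 a b ^ 2 * lam ^ 8 - σ ^ 2 * u ^ 2) / (lam ^ 2 * u ^ 2)
  else
    σ * (u ^ 3 - (lam ^ 2 + σ) * σ ^ 2 * u ^ 2 + r2 a b ^ 2 * lam ^ 4 * σ ^ 3)
      / ((lam ^ 2 + σ) * lam ^ 2 * u ^ 2)

/-- The polynomial `P₊(w)`. -/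
def Pplus (a b lam σ u w : ℝ) : ℝ :=
  w ^ 2 + 2 * σ ^ 2 * ((u + r2 a b * lam ^ 2) / (lam ^ 2 * u)) * w + Pconst a b lam σ u

/-- The polynomial `P₋(w)`. -/
def Pminus (a b lam σ u w : ℝ) : ℝ :=
  w ^ 2 + 2 * σ ^ 2 * ((u - r2 a b * lam ^ 2) / (lam ^ 2 * u)) * w + Pconst a b lam σ u

/-- The state `s` is given by the explicit formulas of the second family, with constants `σ`, `u`
and with the values `w`, `q` of the variables. -/
def SecondFormulas (a b lam σ u w : ℝ) (q : ℂ) (s : State) : Prop :=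
  0 < w ∧
  q ^ 4 - 2 * (Q a b lam σ u w : ℂ) * q ^ 2 + 1 = 0 ∧
  w1 s = q * (√w : ℝ) ∧
  w2 s = (√w : ℝ) / q ∧
  w3 s = (lam : ℂ) / σ * w ∧
  x1 s = 1 / ((σ : ℂ) * u) * (r2 a b * lam ^ 2 * σ ^ 2 - (lam ^ 2 + σ) * u * q ^ 2 * w) ∧
  x2 s = 1 / ((σ : ℂ) * u) * (r2 a b * lam ^ 2 * σ ^ 2 - (lam ^ 2 + σ) * u * (w / q ^ 2)) ∧
  y1 s = (σ : ℂ) * (1 + σ / lam ^ 2 - r2 a b ^ 2 * lam ^ 2 * σ / u ^ 2)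
    + r2 a b * lam ^ 2 / u * q ^ 2 * w ∧
  y2 s = (σ : ℂ) * (1 + σ / lam ^ 2 - r2 a b ^ 2 * lam ^ 2 * σ / u ^ 2)
    + r2 a b * lam ^ 2 / u * (w / q ^ 2) ∧
  z1 s = -((r2 a b : ℂ) * lam * σ / u) * ((√w : ℝ) / q)
    + ((lam : ℂ) ^ 2 + σ) / lam * q * (√w : ℝ) ∧
  z2 s = -((r2 a b : ℂ) * lam * σ / u) * q * (√w : ℝ)
    + ((lam : ℂ) ^ 2 + σ) / lam * ((√w : ℝ) / q)

/-- The trajectories of the second family with constants `σ`, `u`. -/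
def IsSecondMotion (a b lam σ u : ℝ) (γ : ℝ → State) : Prop :=
  IsMotion a b lam γ ∧ σ ≠ 0 ∧ Quintic a b lam σ u ∧
  ∃ (w : ℝ → ℝ) (q : ℝ → ℂ) (w' : ℝ → ℝ), ∀ t,
    SecondFormulas a b lam σ u (w t) (q t) (γ t) ∧
    HasDerivAt w (w' t) t ∧
    w' t ^ 2 = -(lam ^ 2 / (4 * σ ^ 2)) * Pplus a b lam σ u (w t) * Pminus a b lam σ u (w t)

/-! ### Periodicity -/

/-- The trajectory is not a constant. -/
def Nonconstant (γ : ℝ → State) : Prop := ∃ t₁ t₂, γ t₁ ≠ γ t₂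

/-- A non-constant periodic trajectory. -/
def IsPeriodicMotion (γ : ℝ → State) : Prop :=
  Nonconstant γ ∧ ∃ T : ℝ, 0 < T ∧ Function.Periodic γ T

/-- A separatrix: a non-constant trajectory that tends to one and the same equilibrium as
`t → +∞` and as `t → -∞`. -/
def IsSeparatrix (a b lam : ℝ) (γ : ℝ → State) : Prop :=
  Nonconstant γ ∧ ∃ s, IsEquilibrium a b lam s ∧
    Filter.Tendsto γ Filter.atTop (𝓝 s) ∧ Filter.Tendsto γ Filter.atBot (𝓝 s)

end KowalevskiGyrostat

end

/-! The equilibria in the phase space are exactly the zeros of dH, and dK and dG vanish there too,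
so both ranks are 0 at them. Elsewhere both rank conditions ask whether dK (respectively dK and dG)
is a multiple of dH. A tangent vector is a free variation of ω together with an infinitesimal
rotation of the frame (α, β) (`exists_tvec_eq`), so dK = c dH is a finite polynomial system.

Let w = ω₁² + ω₂². If w = 0, the system forces α₃ = β₃ = 0; these are the points of pendulum
motions. If w ≠ 0, put c = 2σ and ζ = x₁ + (λ² + σ) w₁² / σ. The system gives ω₃ = λw/σ and
expresses all other variables through w₁ and ζ (`solve_critical`). The geometric integrals contain
z₁² + x₁y₂ = r², which becomes ζB = r² with B real; since r ≠ 0, ζ = X is real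
(`imaginary_part_eq_zero`). What remains is the family `param`. On both kinds of points dG is also a
multiple of dH, so the condition on G is automatic.

On `param` the orthogonality of α and β is an identity, and |α|², |β|² depend on (ω₁, ω₂) only
through T = `planarH`. This leaves two relations between σ, X and T (`Compatible`). Eliminating T
and writing X = r²λ²σ/u gives the quintic, with T = -`Pconst` / σ². With q = w₁/√w, the biquadratic
equation for q says precisely that `planarH` has the value T (`quadratic_iff`, `Q_mul_eq_iff`).

The family is invariant under the flow. In the (ω₁, ω₂)-plane the motion is, up to a constant
factor, the Hamiltonian flow of `planarH`, whose levels are bounded; hence solutions are global.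
Moreover w'² = f(w) and w'' = F(w), where f is a constant multiple of P₊P₋.

A bounded solution of such a Newton equation is symmetric about each turning point
(`newton_dichotomy`). Two turning points make it periodic, one makes it homoclinic, and none would
require two distinct limits, both common zeros of f and F. A common zero with w > 0 would force a =
0 or b = 0, so only w = 0 is left, and that limit is an equilibrium. The pendulum motions are
treated in the same way with cos φ instead of w. -/

noncomputable section

/-! ### Autonomous differential equations -/

/-- Two global integral curves of a `C¹` vector field that meet at one time coincide. -/
theorem eq_of_hasDerivAt_of_contDiff {E : Type*} [NormedAddCommGroup E] [NormedSpace ℝ E]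
    [CompleteSpace E] {f : E → E} (hf : ContDiff ℝ 1 f) {γ δ : ℝ → E}
    (hγ : ∀ t, HasDerivAt γ (f (γ t)) t) (hδ : ∀ t, HasDerivAt δ (f (δ t)) t) {t₀ : ℝ}
    (h : γ t₀ = δ t₀) : γ = δ := by
  have hf' : ContMDiff (modelWithCornersSelf ℝ E) (modelWithCornersSelf ℝ E).tangent 1
      (fun x => (⟨x, f x⟩ : TangentBundle (modelWithCornersSelf ℝ E) E)) :=
    contMDiff_vectorSpace_iff_contDiff.2 hf
  exact isMIntegralCurve_Ioo_eq_of_contMDiff_boundaryless (t₀ := t₀) hf'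
    (fun t => (hγ t).hasFDerivAt.hasMFDerivAt) (fun t => (hδ t).hasFDerivAt.hasMFDerivAt) h

/-- A globally Lipschitz `C¹` vector field is complete. -/
theorem exists_forall_hasDerivAt_of_lipschitzWith {E : Type*} [NormedAddCommGroup E]
    [NormedSpace ℝ E] [CompleteSpace E] {f : E → E} (hf : ContDiff ℝ 1 f) {K : NNReal}
    (hK : LipschitzWith K f) (x : E) : ∃ γ : ℝ → E, γ 0 = x ∧ ∀ t, HasDerivAt γ (f (γ t)) t := by
  have hf' : ContMDiff (modelWithCornersSelf ℝ E) (modelWithCornersSelf ℝ E).tangent 1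
      (fun x => (⟨x, f x⟩ : TangentBundle (modelWithCornersSelf ℝ E) E)) :=
    contMDiff_vectorSpace_iff_contDiff.2 hf
  -- The existence time must not depend on the initial point y. On the ball of radius ‖f y‖ + 1
  -- about y the field is bounded by ‖f y‖ + K (‖f y‖ + 1) ≤ (K + 1)(‖f y‖ + 1), so during time ε a
  -- solution covers at most half of the radius.
  have hε : (0 : ℝ) < 1 / (2 * ((K : ℝ) + 1)) := by positivity
  set ε : ℝ := 1 / (2 * ((K : ℝ) + 1)) with hεdef
  obtain ⟨γ, h0, h1⟩ := exists_isMIntegralCurve_of_isMIntegralCurveOn hf' hε (fun y => by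
    have hmem : (0 : ℝ) ∈ Set.Icc (-ε) ε := ⟨by linarith, hε.le⟩
    have hPL : IsPicardLindelof (fun _ : ℝ => f) (⟨0, hmem⟩ : Set.Icc (-ε) ε) y
        (‖f y‖₊ + 1) 0 (‖f y‖₊ + K * (‖f y‖₊ + 1)) K := by
      refine ⟨fun t _ => hK.lipschitzOnWith, fun _ _ => continuousOn_const, ?_, ?_⟩
      · intro t _ z hz
        have h1 : ‖f z - f y‖ ≤ K * ‖z - y‖ := by
          simpa [dist_eq_norm] using hK.dist_le_mul z y
        have h2 : ‖z - y‖ ≤ ‖f y‖ + 1 := by simpa [dist_eq_norm] using hz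
        have h3 : ‖f z‖ ≤ ‖f y‖ + ‖f z - f y‖ := by
          simpa using norm_add_le (f y) (f z - f y)
        have h4 : (K : ℝ) * ‖z - y‖ ≤ K * (‖f y‖ + 1) :=
          mul_le_mul_of_nonneg_left h2 K.coe_nonneg
        push_cast
        linarith
      · have hK0 : (0 : ℝ) ≤ K := K.coe_nonneg
        have hy : 0 ≤ ‖f y‖ := norm_nonneg _
        push_cast
        simp only [sub_zero, zero_sub, neg_neg, max_self]
        rw [hεdef, mul_one_div, div_le_iff₀ (by positivity)]
        nlinarith
    obtain ⟨α, hα0, hα⟩ := hPL.exists_eq_forall_mem_Icc_hasDerivWithinAt₀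
    refine ⟨α, hα0, fun t ht => ?_⟩
    have := (hα t (Set.Ioo_subset_Icc_self ht)).hasDerivAt (Icc_mem_nhds ht.1 ht.2)
    exact this.hasFDerivAt.hasMFDerivAt.hasMFDerivWithinAt) x
  refine ⟨γ, h0, fun t => ?_⟩
  have h2 : HasFDerivAt γ ((1 : ℝ →L[ℝ] ℝ).smulRight (f (γ t))) t := (h1 t).hasFDerivAt
  simpa using h2.hasDerivAt

/-- A `C¹` vector field has a global integral curve through every point whose level set, for some
first integral, is bounded. -/
theorem exists_forall_hasDerivAt_of_first_integral {E : Type*} [NormedAddCommGroup E]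
    [NormedSpace ℝ E] [FiniteDimensional ℝ E] {f : E → E} (hf : ContDiff ℝ 1 f) {V : E → ℝ}
    (hV : ∀ (γ : ℝ → E) (t c : ℝ), HasDerivAt γ (c • f (γ t)) t →
      HasDerivAt (fun t => V (γ t)) 0 t) (x : E)
    (hb : Bornology.IsBounded {y | V y = V x}) :
    ∃ γ : ℝ → E, γ 0 = x ∧ (∀ t, HasDerivAt γ (f (γ t)) t) ∧ ∀ t, V (γ t) = V x := by
  have : CompleteSpace E := FiniteDimensional.complete ℝ E
  obtain ⟨R, hR, hbR⟩ := hb.subset_closedBall_lt 0 0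
  -- Cutting off f makes the field compactly supported, hence Lipschitz and complete. Since V is
  -- conserved by every multiple of f, the solution stays on the level set, where χ = 1 and the
  -- field is the original one.
  let χ : ContDiffBump (0 : E) := ⟨R, R + 1, hR, by linarith⟩
  have hg : ContDiff ℝ 1 (fun y => χ y • f y) := χ.contDiff.smul hf
  have hsupp : HasCompactSupport (fun y => χ y • f y) := χ.hasCompactSupport.smul_right
  obtain ⟨K, hK⟩ : ∃ K, LipschitzWith K (fun y => χ y • f y) :=
    ContDiff.lipschitzWith_of_hasCompactSupport hsupp hg (by simp)
  obtain ⟨γ, h0, hγ⟩ := exists_forall_hasDerivAt_of_lipschitzWith hg hK x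
  have hc : ∀ t, HasDerivAt (fun t => V (γ t)) 0 t := fun t => hV γ t _ (hγ t)
  have hconst : ∀ t, V (γ t) = V x := fun t => by
    have := is_const_of_deriv_eq_zero (fun t => (hc t).differentiableAt) (fun t => (hc t).deriv) t 0
    simpa [h0] using this
  refine ⟨γ, h0, fun t => ?_, hconst⟩
  have h1 : χ (γ t) = 1 := χ.one_of_mem_closedBall (hbR (hconst t))
  simpa [h1] using hγ t

end

noncomputable section

/-! ### Bounded motions of a one-dimensional conservative system -/

open Filter in
/-- A limit of a solution of `y'' = F y`, `y' ^ 2 = f y` is a common zero of `f` and `F`. -/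
theorem newton_limit {y v F f : ℝ → ℝ} (hF : Continuous F) (hf : Continuous f)
    (hy : ∀ t, HasDerivAt y (v t) t) (hv : ∀ t, HasDerivAt v (F (y t)) t)
    (hE : ∀ t, v t ^ 2 = f (y t)) {x : ℝ} (hx : Tendsto y atTop (𝓝 x)) : f x = 0 ∧ F x = 0 := by
  -- Mean value theorem on [t, t + 1]: if g converges, its derivative tends to 0 along some times
  -- going to infinity. This is used for y, to get f x = 0, and then for v, to get F x = 0.
  have step : ∀ (g g' : ℝ → ℝ), (∀ t, HasDerivAt g (g' t) t) → ∀ z, Tendsto g atTop (𝓝 z) →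
      ∃ ξ : ℝ → ℝ, Tendsto ξ atTop atTop ∧ Tendsto (fun t => g' (ξ t)) atTop (𝓝 0) := by
    intro g g' hg z hz
    have h1 : ∀ t : ℝ, ∃ c ∈ Set.Ioo t (t + 1), g' c = (g (t + 1) - g t) / (t + 1 - t) := fun t =>
      exists_hasDerivAt_eq_slope g g' (by linarith)
        (fun s _ => (hg s).continuousAt.continuousWithinAt) (fun s _ => hg s)
    choose ξ hξ hξ' using h1
    refine ⟨ξ, tendsto_atTop_mono (fun t => (hξ t).1.le) tendsto_id, ?_⟩
    have h2 : Tendsto (fun t => g (t + 1) - g t) atTop (𝓝 (z - z)) :=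
      (hz.comp (tendsto_atTop_add_const_right _ 1 tendsto_id)).sub hz
    rw [sub_self] at h2
    refine h2.congr fun t => ?_
    rw [hξ' t]
    simp
  have hfx : f x = 0 := by
    obtain ⟨ξ, h1, h2⟩ := step y v hy x hx
    have h3 : Tendsto (fun t => v (ξ t) ^ 2) atTop (𝓝 (f x)) := by
      simp only [hE]
      exact (hf.tendsto x).comp (hx.comp h1)
    simpa using tendsto_nhds_unique h3 (h2.pow 2)
  refine ⟨hfx, ?_⟩
  have hv0 : Tendsto v atTop (𝓝 0) := by
    have h3 : Tendsto (fun t => v t ^ 2) atTop (𝓝 (f x)) := by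
      simp only [hE]
      exact (hf.tendsto x).comp hx
    rw [hfx] at h3
    have h4 : Tendsto (fun t => |v t|) atTop (𝓝 0) := by
      have := (Real.continuous_sqrt.tendsto 0).comp h3
      simpa [Function.comp_def, Real.sqrt_sq_eq_abs] using this
    exact (tendsto_zero_iff_abs_tendsto_zero v).2 h4
  obtain ⟨ξ, h1, h2⟩ := step v (fun t => F (y t)) hv 0 hv0
  exact tendsto_nhds_unique ((hF.tendsto x).comp (hx.comp h1)) h2

/-- A solution of `y'' = F y` is symmetric about the zeros of `y'`. -/
theorem newton_reflection {y v F : ℝ → ℝ} (hF : ContDiff ℝ 1 F)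
    (hy : ∀ t, HasDerivAt y (v t) t) (hv : ∀ t, HasDerivAt v (F (y t)) t) {t₀ : ℝ}
    (h0 : v t₀ = 0) (t : ℝ) : y (2 * t₀ - t) = y t ∧ v (2 * t₀ - t) = -v t := by
  have hf : ContDiff ℝ 1 (fun p : ℝ × ℝ => (p.2, F p.1)) :=
    contDiff_snd.prodMk (hF.comp contDiff_fst)
  have hsub : ∀ t : ℝ, HasDerivAt (fun t => 2 * t₀ - t) (-1) t := fun t => by
    simpa using (hasDerivAt_id t).const_sub (2 * t₀)
  have h := eq_of_hasDerivAt_of_contDiff hf (γ := fun t => (y t, v t))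
    (δ := fun t => (y (2 * t₀ - t), -v (2 * t₀ - t))) (t₀ := t₀)
    (fun t => (hy t).prodMk (hv t))
    (fun t => by
      have h1 := (hy (2 * t₀ - t)).comp t (hsub t)
      have h2 := ((hv (2 * t₀ - t)).comp t (hsub t)).neg
      simp only [mul_neg, mul_one, neg_neg] at h1 h2
      exact h1.prodMk h2)
    (by simp [two_mul, h0])
  have := congrFun h t
  simp only [Prod.mk.injEq] at this
  exact ⟨this.1.symm, by linarith [this.2]⟩

open Filter in
/-- A bounded function converges at infinity if its derivative has no zeros after some time. -/
theorem tendsto_of_deriv_ne_zero {y v : ℝ → ℝ} (hy : ∀ t, HasDerivAt y (v t) t)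
    (hv : Continuous v) {M : ℝ} (hM : ∀ t, |y t| ≤ M) {t₀ : ℝ} (h : ∀ t, t₀ < t → v t ≠ 0) :
    ∃ x, Tendsto y atTop (𝓝 x) := by
  have pos : ∀ (y v : ℝ → ℝ), (∀ t, HasDerivAt y (v t) t) → (∀ t, |y t| ≤ M) →
      (∀ t, t₀ < t → 0 < v t) → ∃ x, Tendsto y atTop (𝓝 x) := by
    intro y v hy hM hpos
    have hmono : StrictMonoOn y (Set.Ici t₀) :=
      strictMonoOn_of_deriv_pos (convex_Ici _)
        (fun s _ => (hy s).continuousAt.continuousWithinAt) (fun s hs => by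
          rw [interior_Ici] at hs
          rw [(hy s).deriv]
          exact hpos s hs)
    have hm : Monotone (fun t => y (max t₀ t)) := fun s t hst =>
      hmono.monotoneOn (Set.mem_Ici.2 (le_max_left _ _)) (Set.mem_Ici.2 (le_max_left _ _))
        (max_le_max le_rfl hst)
    have hb : BddAbove (Set.range fun t => y (max t₀ t)) :=
      ⟨M, by rintro _ ⟨t, rfl⟩; exact (le_abs_self _).trans (hM _)⟩
    have hlim := tendsto_atTop_ciSup hm hb
    refine ⟨_, hlim.congr' ?_⟩
    filter_upwards [eventually_ge_atTop t₀] with t ht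
    simp [ht]
  have hsign : (∀ t, t₀ < t → 0 < v t) ∨ ∀ t, t₀ < t → v t < 0 := by
    by_contra! hcon
    obtain ⟨⟨s, hs, hs'⟩, t, ht, ht'⟩ := hcon
    have hI := isPreconnected_Ioi.intermediate_value (a := s) (b := t) (s := Set.Ioi t₀) hs ht
      hv.continuousOn
    obtain ⟨c, hc, hc'⟩ := hI ⟨hs', ht'⟩
    exact h c hc hc'
  rcases hsign with hs | hs
  · exact pos y v hy hM hs
  · obtain ⟨x, h1⟩ := pos (fun t => -y t) (fun t => -v t) (fun t => (hy t).neg)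
      (fun t => by simpa using hM t) (fun t ht => by linarith [hs t ht])
    exact ⟨-x, by simpa using h1.neg⟩

open Filter in
/-- A bounded solution of `y'' = F y`, `y' ^ 2 = f y` for which `f` and `F` have at most one common
zero in the closure of the range is periodic or has equal limits at both ends. -/
theorem newton_dichotomy {y v F f : ℝ → ℝ} (hF : ContDiff ℝ 1 F) (hf : Continuous f)
    (hy : ∀ t, HasDerivAt y (v t) t) (hv : ∀ t, HasDerivAt v (F (y t)) t)
    (hE : ∀ t, v t ^ 2 = f (y t)) {M : ℝ} (hM : ∀ t, |y t| ≤ M)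
    (huniq : ∀ x ∈ closure (Set.range y), ∀ x' ∈ closure (Set.range y),
      f x = 0 → F x = 0 → f x' = 0 → F x' = 0 → x = x') :
    (∃ T, 0 < T ∧ ∀ t, y (t + T) = y t ∧ v (t + T) = v t) ∨
      ∃ x ∈ closure (Set.range y), f x = 0 ∧ F x = 0 ∧
        Tendsto y atTop (𝓝 x) ∧ Tendsto y atBot (𝓝 x) := by
  have hvc : Continuous v := continuous_iff_continuousAt.2 fun t => (hv t).continuousAt
  have hcl : ∀ {l : Filter ℝ} [l.NeBot] {x : ℝ}, Tendsto y l (𝓝 x) →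
      x ∈ closure (Set.range y) := fun h =>
    mem_closure_of_tendsto h (Eventually.of_forall fun t => Set.mem_range_self t)
  by_cases hz : ∃ t₀, v t₀ = 0
  · obtain ⟨t₀, h0⟩ := hz
    by_cases hz' : ∃ t₁, t₁ ≠ t₀ ∧ v t₁ = 0
    · left
      -- The composition of the reflections about t₀ and t₁ is the translation by 2 (t₁ - t₀).
      have key : ∀ t₀ t₁, t₀ < t₁ → v t₀ = 0 → v t₁ = 0 →
          ∃ T, 0 < T ∧ ∀ t, y (t + T) = y t ∧ v (t + T) = v t := by
        intro t₀ t₁ hlt h0 h1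
        refine ⟨2 * (t₁ - t₀), by linarith, fun t => ?_⟩
        have e : t + 2 * (t₁ - t₀) = 2 * t₁ - (2 * t₀ - t) := by ring
        have r1 := newton_reflection hF hy hv h1 (2 * t₀ - t)
        have r0 := newton_reflection hF hy hv h0 t
        rw [e, r1.1, r1.2, r0.1, r0.2]
        simp
      obtain ⟨t₁, hne, h1⟩ := hz'
      rcases lt_or_gt_of_ne hne with hlt | hlt
      · exact key t₁ t₀ hlt h1 h0
      · exact key t₀ t₁ hlt h0 h1
    · right
      push Not at hz'
      obtain ⟨x, hx⟩ := tendsto_of_deriv_ne_zero hy hvc hM (t₀ := t₀)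
        fun t ht => hz' t ht.ne'
      obtain ⟨h1, h2⟩ := newton_limit hF.continuous hf hy hv hE hx
      refine ⟨x, hcl hx, h1, h2, hx, ?_⟩
      have h3 : Tendsto (fun t => 2 * t₀ - t) atBot atTop :=
        tendsto_atTop_add_const_left _ _ tendsto_neg_atBot_atTop
      exact (hx.comp h3).congr fun t => (newton_reflection hF hy hv h0 t).1
  -- Without turning points y is strictly monotone, so its limits at the two ends differ. Both are
  -- common zeros of f and F, against uniqueness.
  · exfalso
    push Not at hz
    obtain ⟨x, hx⟩ := tendsto_of_deriv_ne_zero hy hvc hM (t₀ := 0) fun t _ => hz t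
    have hn : ∀ t : ℝ, HasDerivAt (fun t => -t) (-1) t := fun t => hasDerivAt_neg t
    have hy' : ∀ t, HasDerivAt (fun t => y (-t)) (-v (-t)) t := fun t => by
      simpa [Function.comp_def] using (hy (-t)).comp t (hn t)
    have hv' : ∀ t, HasDerivAt (fun t => -v (-t)) (F (y (-t))) t := fun t => by
      have h := ((hv (-t)).comp t (hn t)).neg
      rw [mul_neg_one, neg_neg] at h
      exact h
    obtain ⟨z, hzl⟩ := tendsto_of_deriv_ne_zero hy' (by fun_prop) (fun t => hM (-t)) (t₀ := 0)
      fun t _ => neg_ne_zero.2 (hz (-t))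
    obtain ⟨h1, h2⟩ := newton_limit hF.continuous hf hy hv hE hx
    obtain ⟨h3, h4⟩ := newton_limit hF.continuous hf hy' hv' (fun t => by simp [hE]) hzl
    have hzl' : Tendsto y atBot (𝓝 z) := by
      simpa [Function.comp_def] using hzl.comp tendsto_neg_atBot_atTop
    have hxz : x = z := huniq x (hcl hx) z (hcl hzl') h1 h2 h3 h4
    subst hxz
    have hinj : Function.Injective y := by
      intro s t hst
      by_contra hne
      have key : ∀ s t, s < t → y s = y t → False := by
        intro s t hlt hst
        obtain ⟨c, -, hc⟩ := exists_hasDerivAt_eq_zero hlt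
          (fun s _ => (hy s).continuousAt.continuousWithinAt) hst (fun s _ => hy s)
        exact hz c hc
      rcases lt_or_gt_of_ne hne with hlt | hlt
      · exact key s t hlt hst
      · exact key t s hlt hst.symm
    have hcont : Continuous y := continuous_iff_continuousAt.2 fun t => (hy t).continuousAt
    rcases hcont.strictMono_of_inj hinj with hm | hm
    · have h5 : y 0 ≤ x := hm.monotone.ge_of_tendsto hx 0
      have h6 : x ≤ y (-1) := hm.monotone.le_of_tendsto hzl' (-1)
      have h7 : y (-1) < y 0 := hm (by norm_num)
      linarith
    · have h5 : x ≤ y 0 := hm.antitone.le_of_tendsto hx 0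
      have h6 : y (-1) ≤ x := hm.antitone.ge_of_tendsto hzl' (-1)
      have h7 : y 0 < y (-1) := hm (by norm_num)
      linarith

end

noncomputable section

namespace KowalevskiGyrostat

/-! ### Tangent vectors and restricted differentials -/

theorem mem_phaseSpace_iff {a b : ℝ} {s : State} :
    s ∈ phaseSpace a b ↔
      al s 0 ^ 2 + al s 1 ^ 2 + al s 2 ^ 2 = a ^ 2 ∧
      be s 0 ^ 2 + be s 1 ^ 2 + be s 2 ^ 2 = b ^ 2 ∧
      al s 0 * be s 0 + al s 1 * be s 1 + al s 2 * be s 2 = 0 := by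
  simp only [phaseSpace, Set.mem_ofPred_eq, geom, Prod.mk.injEq, dotProduct, Fin.sum_univ_three, sq]

/-- The vector with angular part `δ` obtained by rotating the fields with angular velocity `ξ`. -/
def tvec (s : State) (δ ξ : Fin 3 → ℝ) : State := (δ, al s ⨯₃ ξ, be s ⨯₃ ξ)

/-- Reduces each differential to a one-variable product rule along the line s + t v. -/
theorem fderiv_apply_of_hasDerivAt {F : Type*} [NormedAddCommGroup F] [NormedSpace ℝ F]
    {f : State → F} {s v : State} {d : F} (hf : DifferentiableAt ℝ f s)
    (h : HasDerivAt (fun t : ℝ => f (s + t • v)) d 0) : fderiv ℝ f s v = d := by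
  have h1 : HasLineDerivAt ℝ f (fderiv ℝ f s v) s v := hf.hasFDerivAt.hasLineDerivAt v
  exact HasDerivAt.unique h1 h

section line

variable (s v : State) (i : Fin 3)

theorem hasDerivAt_om_line : HasDerivAt (fun t : ℝ => om (s + t • v) i) (om v i) 0 := by
  simpa [om] using ((hasDerivAt_id (0 : ℝ)).mul_const (om v i)).const_add (om s i)

theorem hasDerivAt_al_line : HasDerivAt (fun t : ℝ => al (s + t • v) i) (al v i) 0 := by
  simpa [al] using ((hasDerivAt_id (0 : ℝ)).mul_const (al v i)).const_add (al s i)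

theorem hasDerivAt_be_line : HasDerivAt (fun t : ℝ => be (s + t • v) i) (be v i) 0 := by
  simpa [be] using ((hasDerivAt_id (0 : ℝ)).mul_const (be v i)).const_add (be s i)

end line

theorem G_eq (a b lam : ℝ) (s : State) :
    G a b lam s =
      1 / 4 * ((2 * om s 0 * al s 0 + 2 * om s 1 * al s 1 + (om s 2 + lam) * al s 2) ^ 2
        + (2 * om s 0 * be s 0 + 2 * om s 1 * be s 1 + (om s 2 + lam) * be s 2) ^ 2)
      + 1 / 2 * (om s 2 - lam) * (2 * om s 0 * (al s 1 * be s 2 - al s 2 * be s 1)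
        + 2 * om s 1 * (al s 2 * be s 0 - al s 0 * be s 2)
        + (om s 2 + lam) * (al s 0 * be s 1 - al s 1 * be s 0))
      - b ^ 2 * al s 0 - a ^ 2 * be s 1 := by
  simp [G, momentum, dotProduct, Fin.sum_univ_three, cross_apply]

theorem differentiable_H : Differentiable ℝ H := by
  unfold H om al be; fun_prop

theorem differentiable_K (lam : ℝ) : Differentiable ℝ (K lam) := by
  unfold K om al be; fun_prop

theorem differentiable_G (a b lam : ℝ) : Differentiable ℝ (G a b lam) := by
  rw [funext (G_eq a b lam)]
  unfold om al be; fun_prop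

theorem geom_eq (s : State) : geom s =
    (al s 0 * al s 0 + al s 1 * al s 1 + al s 2 * al s 2,
     be s 0 * be s 0 + be s 1 * be s 1 + be s 2 * be s 2,
     al s 0 * be s 0 + al s 1 * be s 1 + al s 2 * be s 2) := by
  simp [geom, dotProduct, Fin.sum_univ_three]

theorem differentiable_geom : Differentiable ℝ geom := by
  rw [funext geom_eq]
  unfold al be; fun_prop

theorem fderiv_geom (s v : State) : fderiv ℝ geom s v =
    (2 * (al s 0 * al v 0 + al s 1 * al v 1 + al s 2 * al v 2),
     2 * (be s 0 * be v 0 + be s 1 * be v 1 + be s 2 * be v 2),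
     al v 0 * be s 0 + al v 1 * be s 1 + al v 2 * be s 2
      + (al s 0 * be v 0 + al s 1 * be v 1 + al s 2 * be v 2)) := by
  refine fderiv_apply_of_hasDerivAt (differentiable_geom s) ?_
  simp only [geom_eq]
  have A := hasDerivAt_al_line s v
  have B := hasDerivAt_be_line s v
  refine HasDerivAt.prodMk ?_ (HasDerivAt.prodMk ?_ ?_)
  · exact ((((A 0).mul (A 0)).add ((A 1).mul (A 1))).add ((A 2).mul (A 2))).congr_deriv
      (by simp only [zero_smul, add_zero]; ring)
  · exact ((((B 0).mul (B 0)).add ((B 1).mul (B 1))).add ((B 2).mul (B 2))).congr_deriv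
      (by simp only [zero_smul, add_zero]; ring)
  · exact ((((A 0).mul (B 0)).add ((A 1).mul (B 1))).add ((A 2).mul (B 2))).congr_deriv
      (by simp only [zero_smul, add_zero]; ring)

theorem fderiv_H (s v : State) : fderiv ℝ H s v =
    2 * om s 0 * om v 0 + 2 * om s 1 * om v 1 + om s 2 * om v 2 - al v 0 - be v 1 := by
  refine fderiv_apply_of_hasDerivAt (differentiable_H s) ?_
  have W := hasDerivAt_om_line s v
  have A := hasDerivAt_al_line s v
  have B := hasDerivAt_be_line s v
  exact ((((((W 0).pow 2).add ((W 1).pow 2)).add (((W 2).pow 2).const_mul (1 / 2))).sub (A 0)).sub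
    (B 1)).congr_deriv (by simp only [zero_smul, add_zero]; ring)

theorem fderiv_K (lam : ℝ) (s v : State) : fderiv ℝ (K lam) s v =
    2 * (om s 0 ^ 2 - om s 1 ^ 2 + al s 0 - be s 1)
        * (2 * om s 0 * om v 0 - 2 * om s 1 * om v 1 + al v 0 - be v 1)
      + 2 * (2 * om s 0 * om s 1 + al s 1 + be s 0)
        * (2 * om s 0 * om v 1 + 2 * om s 1 * om v 0 + al v 1 + be v 0)
      + 2 * lam * (om v 2 * (om s 0 ^ 2 + om s 1 ^ 2)
        + (om s 2 - lam) * (2 * om s 0 * om v 0 + 2 * om s 1 * om v 1)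
        + 2 * (om v 0 * al s 2 + om s 0 * al v 2) + 2 * (om v 1 * be s 2 + om s 1 * be v 2)) := by
  refine fderiv_apply_of_hasDerivAt (differentiable_K lam s) ?_
  have W := hasDerivAt_om_line s v
  have A := hasDerivAt_al_line s v
  have B := hasDerivAt_be_line s v
  have h1 := (((((W 0).pow 2).sub ((W 1).pow 2)).add (A 0)).sub (B 1)).pow 2
  have h2 := (((((W 0).const_mul 2).mul (W 1)).add (A 1)).add (B 0)).pow 2
  have h3 := ((((W 2).sub_const lam).mul (((W 0).pow 2).add ((W 1).pow 2))).add
    (((W 0).const_mul 2).mul (A 2))).add (((W 1).const_mul 2).mul (B 2))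
  exact ((h1.add h2).add (h3.const_mul (2 * lam))).congr_deriv
    (by simp only [zero_smul, add_zero, Pi.add_apply, Pi.sub_apply, Pi.mul_apply, Pi.pow_apply]
        ring)

theorem fderiv_G (a b lam : ℝ) (s v : State) : fderiv ℝ (G a b lam) s v =
    1 / 2 * ((2 * om s 0 * al s 0 + 2 * om s 1 * al s 1 + (om s 2 + lam) * al s 2)
        * (2 * (om v 0 * al s 0 + om s 0 * al v 0) + 2 * (om v 1 * al s 1 + om s 1 * al v 1)
          + (om v 2 * al s 2 + (om s 2 + lam) * al v 2))
      + (2 * om s 0 * be s 0 + 2 * om s 1 * be s 1 + (om s 2 + lam) * be s 2)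
        * (2 * (om v 0 * be s 0 + om s 0 * be v 0) + 2 * (om v 1 * be s 1 + om s 1 * be v 1)
          + (om v 2 * be s 2 + (om s 2 + lam) * be v 2)))
    + 1 / 2 * om v 2 * (2 * om s 0 * (al s 1 * be s 2 - al s 2 * be s 1)
        + 2 * om s 1 * (al s 2 * be s 0 - al s 0 * be s 2)
        + (om s 2 + lam) * (al s 0 * be s 1 - al s 1 * be s 0))
    + 1 / 2 * (om s 2 - lam) *
      (2 * om v 0 * (al s 1 * be s 2 - al s 2 * be s 1)
        + 2 * om v 1 * (al s 2 * be s 0 - al s 0 * be s 2)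
        + om v 2 * (al s 0 * be s 1 - al s 1 * be s 0)
        + 2 * om s 0 * (al v 1 * be s 2 + al s 1 * be v 2 - al v 2 * be s 1 - al s 2 * be v 1)
        + 2 * om s 1 * (al v 2 * be s 0 + al s 2 * be v 0 - al v 0 * be s 2 - al s 0 * be v 2)
        + (om s 2 + lam) * (al v 0 * be s 1 + al s 0 * be v 1 - al v 1 * be s 0 - al s 1 * be v 0))
    - b ^ 2 * al v 0 - a ^ 2 * be v 1 := by
  refine fderiv_apply_of_hasDerivAt (differentiable_G a b lam s) ?_
  simp only [G_eq]
  have W := hasDerivAt_om_line s v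
  have A := hasDerivAt_al_line s v
  have B := hasDerivAt_be_line s v
  have h1 := (((((W 0).const_mul 2).mul (A 0)).add (((W 1).const_mul 2).mul (A 1))).add
    (((W 2).add_const lam).mul (A 2))).pow 2
  have h2 := (((((W 0).const_mul 2).mul (B 0)).add (((W 1).const_mul 2).mul (B 1))).add
    (((W 2).add_const lam).mul (B 2))).pow 2
  have n0 := ((A 1).mul (B 2)).sub ((A 2).mul (B 1))
  have n1 := ((A 2).mul (B 0)).sub ((A 0).mul (B 2))
  have n2 := ((A 0).mul (B 1)).sub ((A 1).mul (B 0))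
  have h3 := ((((W 0).const_mul 2).mul n0).add (((W 1).const_mul 2).mul n1)).add
    (((W 2).add_const lam).mul n2)
  exact (((((h1.add h2).const_mul (1 / 4)).add ((((W 2).sub_const lam).const_mul (1 / 2)).mul
    h3)).sub ((A 0).const_mul (b ^ 2))).sub ((B 1).const_mul (a ^ 2))).congr_deriv
    (by simp only [zero_smul, add_zero, Pi.add_apply, Pi.sub_apply, Pi.mul_apply]
        ring)

theorem mem_tangentSpace_iff {s v : State} : v ∈ tangentSpace s ↔
    al s 0 * al v 0 + al s 1 * al v 1 + al s 2 * al v 2 = 0 ∧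
    be s 0 * be v 0 + be s 1 * be v 1 + be s 2 * be v 2 = 0 ∧
    al v 0 * be s 0 + al v 1 * be s 1 + al v 2 * be s 2
      + (al s 0 * be v 0 + al s 1 * be v 1 + al s 2 * be v 2) = 0 := by
  simp [tangentSpace, LinearMap.mem_ker, fderiv_geom, Prod.ext_iff]

theorem tvec_mem_tangentSpace (s : State) (δ ξ : Fin 3 → ℝ) : tvec s δ ξ ∈ tangentSpace s := by
  rw [mem_tangentSpace_iff]
  have hA : ∀ i, al (tvec s δ ξ) i = (al s ⨯₃ ξ) i := fun _ => rfl
  have hB : ∀ i, be (tvec s δ ξ) i = (be s ⨯₃ ξ) i := fun _ => rfl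
  simp only [hA, hB, cross_apply, Matrix.cons_val_zero, Matrix.cons_val_one, Matrix.cons_val]
  refine ⟨?_, ?_, ?_⟩ <;> ring

/-- A vector orthogonal to `α`, `β` and `α × β` vanishes. -/
theorem eq_zero_of_orthogonal {a b : ℝ} (ha : a ≠ 0) (hb : b ≠ 0) {s : State}
    (hs : s ∈ phaseSpace a b) {d0 d1 d2 : ℝ}
    (h1 : al s 0 * d0 + al s 1 * d1 + al s 2 * d2 = 0)
    (h2 : be s 0 * d0 + be s 1 * d1 + be s 2 * d2 = 0)
    (h3 : (al s 1 * be s 2 - al s 2 * be s 1) * d0 + (al s 2 * be s 0 - al s 0 * be s 2) * d1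
      + (al s 0 * be s 1 - al s 1 * be s 0) * d2 = 0) : d0 = 0 ∧ d1 = 0 ∧ d2 = 0 := by
  obtain ⟨g1, g2, g3⟩ := mem_phaseSpace_iff.1 hs
  set A := al s 0 * d0 + al s 1 * d1 + al s 2 * d2 with hA
  set B := be s 0 * d0 + be s 1 * d1 + be s 2 * d2 with hB
  set C := al s 0 * be s 0 + al s 1 * be s 1 + al s 2 * be s 2 with hC
  set N := (al s 1 * be s 2 - al s 2 * be s 1) * d0 + (al s 2 * be s 0 - al s 0 * be s 2) * d1
      + (al s 0 * be s 1 - al s 1 * be s 0) * d2 with hN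
  -- The square of the triple product N is the Gram determinant of α, β, d.
  have gram : a ^ 2 * b ^ 2 * (d0 ^ 2 + d1 ^ 2 + d2 ^ 2) = N ^ 2 - 2 * C * B * A
      + a ^ 2 * B ^ 2 + b ^ 2 * A ^ 2 + (d0 ^ 2 + d1 ^ 2 + d2 ^ 2) * C ^ 2 := by
    rw [← g1, ← g2, hA, hB, hC, hN]
    ring
  rw [h1, h2, g3, h3] at gram
  have hd : d0 ^ 2 + d1 ^ 2 + d2 ^ 2 = 0 := by
    have : a ^ 2 * b ^ 2 ≠ 0 := by positivity
    exact (mul_eq_zero.1 (by linarith : a ^ 2 * b ^ 2 * (d0 ^ 2 + d1 ^ 2 + d2 ^ 2) = 0)).resolve_left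
      this
  refine ⟨?_, ?_, ?_⟩ <;> apply pow_eq_zero_iff two_ne_zero |>.1 <;>
    linarith [sq_nonneg d0, sq_nonneg d1, sq_nonneg d2]

/-- Since |α|, |β| and α · β are fixed, the pair (α, β) is a rigid frame, and its first-order
variations are infinitesimal rotations. Hence identities between restricted differentials can be
tested on free parameters δ, ξ. -/
theorem exists_tvec_eq {a b : ℝ} (ha : a ≠ 0) (hb : b ≠ 0) {s : State} (hs : s ∈ phaseSpace a b)
    {v : State} (hv : v ∈ tangentSpace s) : ∃ δ ξ, v = tvec s δ ξ := by
  obtain ⟨g1, g2, g3⟩ := mem_phaseSpace_iff.1 hs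
  obtain ⟨t1, t2, t3⟩ := mem_tangentSpace_iff.1 hv
  obtain ⟨n0, hn0⟩ : ∃ n, n = al s 1 * be s 2 - al s 2 * be s 1 := ⟨_, rfl⟩
  obtain ⟨n1, hn1⟩ : ∃ n, n = al s 2 * be s 0 - al s 0 * be s 2 := ⟨_, rfl⟩
  obtain ⟨n2, hn2⟩ : ∃ n, n = al s 0 * be s 1 - al s 1 * be s 0 := ⟨_, rfl⟩
  have hαn : al s 0 * n0 + al s 1 * n1 + al s 2 * n2 = 0 := by rw [hn0, hn1, hn2]; ring
  have hβn : be s 0 * n0 + be s 1 * n1 + be s 2 * n2 = 0 := by rw [hn0, hn1, hn2]; ring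
  have hnn : n0 ^ 2 + n1 ^ 2 + n2 ^ 2 = a ^ 2 * b ^ 2 := by
    rw [← g1, ← g2, hn0, hn1, hn2]
    linear_combination -(al s 0 * be s 0 + al s 1 * be s 1 + al s 2 * be s 2) * g3
  -- Coefficients of ξ = -pα + qβ - rn in the orthogonal frame α, β, n = α × β, read off from β × ξ
  -- · n = p|n|², α × ξ · n = q|n|² and α × ξ · β = r|n|², where |n|² = a²b².
  obtain ⟨p, hp⟩ : ∃ p, p = (be v 0 * n0 + be v 1 * n1 + be v 2 * n2) / (a ^ 2 * b ^ 2) := ⟨_, rfl⟩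
  obtain ⟨q, hq⟩ : ∃ q, q = (al v 0 * n0 + al v 1 * n1 + al v 2 * n2) / (a ^ 2 * b ^ 2) := ⟨_, rfl⟩
  obtain ⟨r, hr⟩ : ∃ r, r = (al v 0 * be s 0 + al v 1 * be s 1 + al v 2 * be s 2)
    / (a ^ 2 * b ^ 2) := ⟨_, rfl⟩
  have hab : a ^ 2 * b ^ 2 ≠ 0 := by positivity
  rw [eq_div_iff hab] at hp hq hr
  obtain ⟨ξ, hξ⟩ : ∃ ξ : Fin 3 → ℝ, ξ = ![-p * al s 0 + q * be s 0 - r * n0,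
    -p * al s 1 + q * be s 1 - r * n1, -p * al s 2 + q * be s 2 - r * n2] := ⟨_, rfl⟩
  have x0 : ξ 0 = -p * al s 0 + q * be s 0 - r * n0 := by rw [hξ]; rfl
  have x1 : ξ 1 = -p * al s 1 + q * be s 1 - r * n1 := by rw [hξ]; rfl
  have x2 : ξ 2 = -p * al s 2 + q * be s 2 - r * n2 := by rw [hξ]; rfl
  have hαξ : al s 0 * ξ 0 + al s 1 * ξ 1 + al s 2 * ξ 2 = -p * a ^ 2 := by
    rw [x0, x1, x2]
    linear_combination -p * g1 + q * g3 - r * hαn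
  have hβξ : be s 0 * ξ 0 + be s 1 * ξ 1 + be s 2 * ξ 2 = q * b ^ 2 := by
    rw [x0, x1, x2]
    linear_combination -p * g3 + q * g2 - r * hβn
  have hnξ : n0 * ξ 0 + n1 * ξ 1 + n2 * ξ 2 = -r * (a ^ 2 * b ^ 2) := by
    rw [x0, x1, x2]
    linear_combination -p * hαn + q * hβn - r * hnn
  refine ⟨om v, ξ, ?_⟩
  obtain ⟨a0, a1, a2⟩ := eq_zero_of_orthogonal ha hb hs
    (d0 := al v 0 - (al s 1 * ξ 2 - al s 2 * ξ 1)) (d1 := al v 1 - (al s 2 * ξ 0 - al s 0 * ξ 2))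
    (d2 := al v 2 - (al s 0 * ξ 1 - al s 1 * ξ 0))
    (by linear_combination t1)
    (by rw [hn0, hn1, hn2] at hnξ; linear_combination hnξ - hr)
    (by
      rw [hn0, hn1, hn2] at hq
      linear_combination -hq - a ^ 2 * hβξ
        - (be s 0 * ξ 0 + be s 1 * ξ 1 + be s 2 * ξ 2) * g1
        + (al s 0 * ξ 0 + al s 1 * ξ 1 + al s 2 * ξ 2) * g3)
  obtain ⟨b0, b1, b2⟩ := eq_zero_of_orthogonal ha hb hs
    (d0 := be v 0 - (be s 1 * ξ 2 - be s 2 * ξ 1)) (d1 := be v 1 - (be s 2 * ξ 0 - be s 0 * ξ 2))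
    (d2 := be v 2 - (be s 0 * ξ 1 - be s 1 * ξ 0))
    (by rw [hn0, hn1, hn2] at hnξ; linear_combination t3 - hnξ + hr)
    (by linear_combination t2)
    (by
      rw [hn0, hn1, hn2] at hp
      linear_combination -hp + b ^ 2 * hαξ
        + (al s 0 * ξ 0 + al s 1 * ξ 1 + al s 2 * ξ 2) * g2
        - (be s 0 * ξ 0 + be s 1 * ξ 1 + be s 2 * ξ 2) * g3)
  refine Prod.ext rfl (Prod.ext ?_ ?_)
  · change al v = al s ⨯₃ ξ
    ext i
    fin_cases i <;> simp [cross_apply] <;> linarith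
  · change be v = be s ⨯₃ ξ
    ext i
    fin_cases i <;> simp [cross_apply] <;> linarith

theorem dres_apply (f : State → ℝ) (s : State) (v : tangentSpace s) :
    dres f s v = fderiv ℝ f s v := rfl

theorem dres_eq_smul_iff {a b : ℝ} (ha : a ≠ 0) (hb : b ≠ 0) {s : State}
    (hs : s ∈ phaseSpace a b) (f g : State → ℝ) (c : ℝ) :
    dres f s = c • dres g s ↔
      ∀ δ ξ, fderiv ℝ f s (tvec s δ ξ) = c * fderiv ℝ g s (tvec s δ ξ) := by
  constructor
  · intro h δ ξ
    exact DFunLike.congr_fun h ⟨tvec s δ ξ, tvec_mem_tangentSpace s δ ξ⟩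
  · intro h
    ext ⟨v, hv⟩
    obtain ⟨δ, ξ, rfl⟩ := exists_tvec_eq ha hb hs hv
    exact h δ ξ

end KowalevskiGyrostat

end

/-! ### Tangent vectors in coordinates, ranks and equilibria -/

noncomputable section

namespace KowalevskiGyrostat

section tvec

variable (s : State) (δ ξ : Fin 3 → ℝ)

theorem om_tvec : om (tvec s δ ξ) = δ := rfl

theorem al_tvec_zero : al (tvec s δ ξ) 0 = al s 1 * ξ 2 - al s 2 * ξ 1 := by
  simp [al, tvec, cross_apply]

theorem al_tvec_one : al (tvec s δ ξ) 1 = al s 2 * ξ 0 - al s 0 * ξ 2 := by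
  simp [al, tvec, cross_apply]

theorem al_tvec_two : al (tvec s δ ξ) 2 = al s 0 * ξ 1 - al s 1 * ξ 0 := by
  simp [al, tvec, cross_apply]

theorem be_tvec_zero : be (tvec s δ ξ) 0 = be s 1 * ξ 2 - be s 2 * ξ 1 := by
  simp [be, tvec, cross_apply]

theorem be_tvec_one : be (tvec s δ ξ) 1 = be s 2 * ξ 0 - be s 0 * ξ 2 := by
  simp [be, tvec, cross_apply]

theorem be_tvec_two : be (tvec s δ ξ) 2 = be s 0 * ξ 1 - be s 1 * ξ 0 := by
  simp [be, tvec, cross_apply]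

end tvec

/-! ### Ranks -/

theorem finrank_span_pair_eq_one_iff {V : Type*} [AddCommGroup V] [Module ℝ V] {k h : V}
    (hh : h ≠ 0) : Module.finrank ℝ (Submodule.span ℝ {k, h}) = 1 ↔ ∃ c : ℝ, k = c • h := by
  have hle : Submodule.span ℝ {h} ≤ Submodule.span ℝ {k, h} := Submodule.span_mono (by simp)
  constructor
  · intro h1
    have : FiniteDimensional ℝ (Submodule.span ℝ {k, h}) :=
      FiniteDimensional.span_of_finite ℝ (by simp)
    have he : Submodule.span ℝ {h} = Submodule.span ℝ {k, h} :=
      Submodule.eq_of_le_of_finrank_eq hle (by rw [h1, finrank_span_singleton hh])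
    have hk : k ∈ Submodule.span ℝ {h} := he ▸ Submodule.subset_span (by simp)
    obtain ⟨c, hc⟩ := Submodule.mem_span_singleton.1 hk
    exact ⟨c, hc.symm⟩
  · rintro ⟨c, rfl⟩
    have he : Submodule.span ℝ {c • h, h} = Submodule.span ℝ {h} := by
      refine le_antisymm (Submodule.span_le.2 ?_) hle
      rintro x (rfl | rfl)
      · exact Submodule.smul_mem _ _ (Submodule.mem_span_singleton_self _)
      · exact Submodule.mem_span_singleton_self _
    rw [he, finrank_span_singleton hh]

theorem rankKH_eq_one_iff (lam : ℝ) {s : State} (h : dres H s ≠ 0) :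
    rankKH lam s = 1 ↔ ∃ c : ℝ, dres (K lam) s = c • dres H s :=
  finrank_span_pair_eq_one_iff h

theorem rankKH_eq_zero (lam : ℝ) {s : State} (h : dres H s = 0) (hK : dres (K lam) s = 0) :
    rankKH lam s = 0 := by
  simp [rankKH, h, hK]

theorem fderiv_J (a b lam : ℝ) (s v : State) : fderiv ℝ (J a b lam) s v =
    (fderiv ℝ (G a b lam) s v, fderiv ℝ (K lam) s v, fderiv ℝ H s v) := by
  have hG := (differentiable_G a b lam s).hasFDerivAt
  have hK := (differentiable_K lam s).hasFDerivAt
  have hH := (differentiable_H s).hasFDerivAt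
  have : HasFDerivAt (J a b lam) _ s := hG.prodMk (hK.prodMk hH)
  rw [this.fderiv]
  rfl

theorem rankJ_eq_zero (a b lam : ℝ) {s : State} (h : dres H s = 0) (hK : dres (K lam) s = 0)
    (hG : dres (G a b lam) s = 0) : rankJ a b lam s = 0 := by
  have : (fderiv ℝ (J a b lam) s).toLinearMap.domRestrict (tangentSpace s) = 0 := by
    ext1 v
    have h1 := DFunLike.congr_fun h v
    have h2 := DFunLike.congr_fun hK v
    have h3 := DFunLike.congr_fun hG v
    simp only [dres_apply, LinearMap.zero_apply] at h1 h2 h3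
    simp [fderiv_J, h1, h2, h3]
  rw [rankJ, this]
  simp

/-- The image of the differential of J is a line exactly when it is spanned by a single vector; its
H-component is nonzero because dH ≠ 0, and normalizing it to 1 turns the other two components into
the multipliers. -/
theorem rankJ_eq_one_iff (a b lam : ℝ) {s : State} (h : dres H s ≠ 0) :
    rankJ a b lam s = 1 ↔ (∃ c : ℝ, dres (K lam) s = c • dres H s) ∧
      ∃ c : ℝ, dres (G a b lam) s = c • dres H s := by
  obtain ⟨v₀, hv₀⟩ : ∃ v₀, dres H s v₀ ≠ 0 := by
    by_contra! hcon
    exact h (LinearMap.ext hcon)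
  have happ : ∀ v : tangentSpace s, (fderiv ℝ (J a b lam) s).toLinearMap.domRestrict
      (tangentSpace s) v = (dres (G a b lam) s v, dres (K lam) s v, dres H s v) := fun v =>
    fderiv_J a b lam s v
  constructor
  · intro h1
    obtain ⟨⟨w, hw⟩, hw0, hspan⟩ := finrank_eq_one_iff'.1 h1
    have key : ∀ v : tangentSpace s, ∃ c : ℝ,
        c • w = (dres (G a b lam) s v, dres (K lam) s v, dres H s v) := fun v => by
      obtain ⟨c, hc⟩ := hspan ⟨_, LinearMap.mem_range_self _ v⟩
      exact ⟨c, by rw [← happ]; exact congrArg Subtype.val hc⟩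
    obtain ⟨g, k, m⟩ := w
    have hm : m ≠ 0 := by
      rintro rfl
      obtain ⟨c, hc⟩ := key v₀
      simp only [Prod.smul_mk, smul_zero, Prod.mk.injEq] at hc
      exact hv₀ hc.2.2.symm
    refine ⟨⟨k / m, LinearMap.ext fun v => ?_⟩, ⟨g / m, LinearMap.ext fun v => ?_⟩⟩ <;>
    · obtain ⟨c, hc⟩ := key v
      simp only [Prod.smul_mk, smul_eq_mul, Prod.mk.injEq] at hc
      obtain ⟨e1, e2, e3⟩ := hc
      rw [LinearMap.smul_apply, ← e3, smul_eq_mul]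
      first | rw [← e2] | rw [← e1]
      field_simp
  · rintro ⟨⟨c, hc⟩, d, hd⟩
    have hw : ((d, c, 1) : ℝ × ℝ × ℝ) ≠ 0 := by simp
    have : LinearMap.range ((fderiv ℝ (J a b lam) s).toLinearMap.domRestrict (tangentSpace s))
        = Submodule.span ℝ {((d, c, 1) : ℝ × ℝ × ℝ)} := by
      have hv : ∀ v, (fderiv ℝ (J a b lam) s).toLinearMap.domRestrict (tangentSpace s) v
          = dres H s v • ((d, c, 1) : ℝ × ℝ × ℝ) := fun v => by
        rw [happ, hc, hd]
        simp [mul_comm]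
      refine le_antisymm ?_ ?_
      · rintro _ ⟨v, rfl⟩
        rw [hv]
        exact Submodule.smul_mem _ _ (Submodule.mem_span_singleton_self _)
      · rw [Submodule.span_singleton_le_iff_mem]
        refine ⟨(dres H s v₀)⁻¹ • v₀, ?_⟩
        rw [map_smul, hv, inv_smul_smul₀ hv₀]
    rw [rankJ, this, finrank_span_singleton hw]

/-! ### Equilibria -/

/-- Vanishing of α × ω and β × ω for independent α, β gives ω = 0; then α₃ = β₃ = 0 and α₂ = β₁.
Orthogonality becomes α₂ (α₁ + β₂) = 0, and α₂ ≠ 0 would give β₂ = -α₁, hence |α| = |β|, which b < a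
excludes. -/
theorem field_eq_zero_iff {a b : ℝ} (hb : 0 < b) (hab : b < a) (lam : ℝ) {s : State}
    (hs : s ∈ phaseSpace a b) :
    field lam s = 0 ↔ (om s 0 = 0 ∧ om s 1 = 0 ∧ om s 2 = 0) ∧
      al s 1 = 0 ∧ al s 2 = 0 ∧ be s 0 = 0 ∧ be s 2 = 0 := by
  obtain ⟨g1, g2, g3⟩ := mem_phaseSpace_iff.1 hs
  have ha : 0 < a := hb.trans hab
  have hcomp : field lam s = 0 ↔
      ((om s 1 * (om s 2 - lam) + be s 2) / 2 = 0 ∧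
        (-(om s 0) * (om s 2 - lam) - al s 2) / 2 = 0 ∧ al s 1 - be s 0 = 0) ∧
      (al s 1 * om s 2 - al s 2 * om s 1 = 0 ∧ al s 2 * om s 0 - al s 0 * om s 2 = 0 ∧
        al s 0 * om s 1 - al s 1 * om s 0 = 0) ∧
      (be s 1 * om s 2 - be s 2 * om s 1 = 0 ∧ be s 2 * om s 0 - be s 0 * om s 2 = 0 ∧
        be s 0 * om s 1 - be s 1 * om s 0 = 0) := by
    simp only [field, cross_apply, Prod.ext_iff, funext_iff, Fin.forall_fin_succ, Prod.fst_zero,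
      Prod.snd_zero, Pi.zero_apply]
    simp
  rw [hcomp]
  constructor
  · rintro ⟨⟨w0, w1, w2⟩, ⟨a0, a1, a2⟩, b0, b1, b2⟩
    have hβ : be s 0 * om s 0 + be s 1 * om s 1 + be s 2 * om s 2 = 0 := by
      have : a ^ 2 * (be s 0 * om s 0 + be s 1 * om s 1 + be s 2 * om s 2) = 0 := by
        rw [← g1]
        linear_combination (al s 0 * om s 0 + al s 1 * om s 1 + al s 2 * om s 2) * g3
          + (al s 1 * be s 2 - al s 2 * be s 1) * a0 + (al s 2 * be s 0 - al s 0 * be s 2) * a1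
          + (al s 0 * be s 1 - al s 1 * be s 0) * a2
      exact (mul_eq_zero.1 this).resolve_left (by positivity)
    have hα : al s 0 * om s 0 + al s 1 * om s 1 + al s 2 * om s 2 = 0 := by
      have : b ^ 2 * (al s 0 * om s 0 + al s 1 * om s 1 + al s 2 * om s 2) = 0 := by
        rw [← g2]
        linear_combination (be s 0 * om s 0 + be s 1 * om s 1 + be s 2 * om s 2) * g3
          - (al s 1 * be s 2 - al s 2 * be s 1) * b0 - (al s 2 * be s 0 - al s 0 * be s 2) * b1
          - (al s 0 * be s 1 - al s 1 * be s 0) * b2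
      exact (mul_eq_zero.1 this).resolve_left (by positivity)
    obtain ⟨o0, o1, o2⟩ := eq_zero_of_orthogonal ha.ne' hb.ne' hs hα hβ
      (by linear_combination al s 0 * b0 + al s 1 * b1 + al s 2 * b2)
    have hα2 : al s 2 = 0 := by rw [o0] at w1; linarith
    have hβ2 : be s 2 = 0 := by rw [o1] at w0; linarith
    have hα1 : al s 1 = 0 := by
      by_contra hne
      rw [hα2] at g1
      rw [hα2, ← sub_eq_zero.1 w2] at g3
      rw [hβ2, ← sub_eq_zero.1 w2] at g2
      have : be s 1 = -al s 0 := by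
        have h1 : al s 1 * (al s 0 + be s 1) = 0 := by linear_combination g3
        linarith [(mul_eq_zero.1 h1).resolve_left hne]
      rw [this] at g2
      nlinarith
    exact ⟨⟨o0, o1, o2⟩, hα1, hα2, by linarith, hβ2⟩
  · rintro ⟨⟨h1, h2, h3⟩, h4, h5, h6, h7⟩
    simp [h1, h2, h3, h4, h5, h6, h7]

theorem dres_H_eq_zero_iff {a b : ℝ} (hb : 0 < b) (hab : b < a) (lam : ℝ) {s : State}
    (hs : s ∈ phaseSpace a b) : dres H s = 0 ↔ field lam s = 0 := by
  have ha : 0 < a := hb.trans hab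
  have h0 : dres H s = 0 ↔ dres H s = (0 : ℝ) • dres H s := by rw [zero_smul]
  rw [h0, dres_eq_smul_iff ha.ne' hb.ne' hs]
  simp only [fderiv_H, om_tvec, al_tvec_zero, be_tvec_one, zero_mul]
  constructor
  · intro h
    obtain ⟨g1, g2, g3⟩ := mem_phaseSpace_iff.1 hs
    -- Variations of ω alone give ω = 0; rotations about the three axes give β₃ = 0, α₃ = 0 and α₂ =
    -- β₁.
    have e0 := h ![1, 0, 0] 0
    have e1 := h ![0, 1, 0] 0
    have e2 := h ![0, 0, 1] 0
    have f0 := h 0 ![1, 0, 0]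
    have f1 := h 0 ![0, 1, 0]
    have f2 := h 0 ![0, 0, 1]
    simp at e0 e1 e2 f0 f1 f2
    have ea : al s 1 = be s 0 := by linarith
    rw [field]
    simp [e0, e1, e2, f0, f1, ea, show om s = 0 by ext i; fin_cases i <;> simp [*]]
  · intro h δ ξ
    obtain ⟨⟨h1, h2, h3⟩, h4, h5, h6, h7⟩ := (field_eq_zero_iff hb hab lam hs).1 h
    rw [h1, h2, h3, h4, h5, h6, h7]
    ring

theorem dres_K_eq_zero_of_field_eq_zero {a b : ℝ} (hb : 0 < b) (hab : b < a) {lam : ℝ} {s : State}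
    (hs : s ∈ phaseSpace a b) (h : field lam s = 0) : dres (K lam) s = 0 := by
  have ha : 0 < a := hb.trans hab
  have h0 : dres (K lam) s = 0 ↔ dres (K lam) s = (0 : ℝ) • dres H s := by rw [zero_smul]
  rw [h0, dres_eq_smul_iff ha.ne' hb.ne' hs]
  intro δ ξ
  obtain ⟨⟨h1, h2, h3⟩, h4, h5, h6, h7⟩ := (field_eq_zero_iff hb hab lam hs).1 h
  rw [fderiv_K]
  simp only [om_tvec, al_tvec_zero, al_tvec_one, al_tvec_two, be_tvec_zero, be_tvec_one,
    be_tvec_two, h1, h2, h3, h4, h5, h6, h7]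
  ring

theorem dres_G_eq_zero_of_field_eq_zero {a b : ℝ} (hb : 0 < b) (hab : b < a) {lam : ℝ} {s : State}
    (hs : s ∈ phaseSpace a b) (h : field lam s = 0) : dres (G a b lam) s = 0 := by
  have ha : 0 < a := hb.trans hab
  have h0 : dres (G a b lam) s = 0 ↔ dres (G a b lam) s = (0 : ℝ) • dres H s := by rw [zero_smul]
  rw [h0, dres_eq_smul_iff ha.ne' hb.ne' hs]
  intro δ ξ
  obtain ⟨⟨h1, h2, h3⟩, h4, h5, h6, h7⟩ := (field_eq_zero_iff hb hab lam hs).1 h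
  rw [fderiv_G]
  simp only [om_tvec, al_tvec_zero, al_tvec_one, al_tvec_two, be_tvec_zero, be_tvec_one,
    be_tvec_two, h1, h2, h3, h4, h5, h6, h7]
  ring

end KowalevskiGyrostat

end

noncomputable section

namespace KowalevskiGyrostat

/-! ### Parametrization of the points where `dK = 2 σ dH` -/

/-- The points with `dK = 2 σ dH`, in terms of the equatorial components of `ω`; `X` stands for
`r² λ² σ / u`. -/
def param (lam σ X o₁ o₂ : ℝ) : State :=
  (![o₁, o₂, lam / σ * (o₁ ^ 2 + o₂ ^ 2)],
   ![(X + (σ * (lam ^ 2 + σ) - X ^ 2) / lam ^ 2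
        + (X - (lam ^ 2 + σ)) * (o₁ ^ 2 - o₂ ^ 2) / σ) / 2,
     (X - (lam ^ 2 + σ)) * (o₁ * o₂) / σ,
     ((lam ^ 2 + σ) - X) * o₁ / lam],
   ![-(X + (lam ^ 2 + σ)) * (o₁ * o₂) / σ,
     ((σ * (lam ^ 2 + σ) - X ^ 2) / lam ^ 2 - X
        + (X + (lam ^ 2 + σ)) * (o₁ ^ 2 - o₂ ^ 2) / σ) / 2,
     ((lam ^ 2 + σ) + X) * o₂ / lam])

/-- The Hamiltonian of the reduced planar system. -/
def planarH (lam σ X o₁ o₂ : ℝ) : ℝ :=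
  (o₁ ^ 2 + o₂ ^ 2) ^ 2 / σ ^ 2 + 2 * (o₁ ^ 2 + o₂ ^ 2) / lam ^ 2
    - 2 * (o₁ ^ 2 - o₂ ^ 2) * X / (σ * lam ^ 2)

/-- The value `T` of the planar Hamiltonian is compatible with the geometric integrals. -/
def Compatible (a b lam σ X T : ℝ) : Prop :=
  4 * a ^ 2 = (X + (σ * (lam ^ 2 + σ) - X ^ 2) / lam ^ 2) ^ 2 + (lam ^ 2 + σ - X) ^ 2 * T ∧
  4 * b ^ 2 = (X - (σ * (lam ^ 2 + σ) - X ^ 2) / lam ^ 2) ^ 2 + (lam ^ 2 + σ + X) ^ 2 * T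

section

variable (lam σ X o₁ o₂ : ℝ)

theorem om_param_zero : om (param lam σ X o₁ o₂) 0 = o₁ := rfl
theorem om_param_one : om (param lam σ X o₁ o₂) 1 = o₂ := rfl
theorem om_param_two : om (param lam σ X o₁ o₂) 2 = lam / σ * (o₁ ^ 2 + o₂ ^ 2) := rfl
theorem al_param_zero : al (param lam σ X o₁ o₂) 0 =
  (X + (σ * (lam ^ 2 + σ) - X ^ 2) / lam ^ 2
        + (X - (lam ^ 2 + σ)) * (o₁ ^ 2 - o₂ ^ 2) / σ) / 2 := rfl
theorem al_param_one : al (param lam σ X o₁ o₂) 1 = (X - (lam ^ 2 + σ)) * (o₁ * o₂) / σ := rfl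
theorem al_param_two : al (param lam σ X o₁ o₂) 2 = ((lam ^ 2 + σ) - X) * o₁ / lam := rfl
theorem be_param_zero : be (param lam σ X o₁ o₂) 0 = -(X + (lam ^ 2 + σ)) * (o₁ * o₂) / σ := rfl
theorem be_param_one : be (param lam σ X o₁ o₂) 1 =
  ((σ * (lam ^ 2 + σ) - X ^ 2) / lam ^ 2 - X
        + (X + (lam ^ 2 + σ)) * (o₁ ^ 2 - o₂ ^ 2) / σ) / 2 := rfl
theorem be_param_two : be (param lam σ X o₁ o₂) 2 = ((lam ^ 2 + σ) + X) * o₂ / lam := rfl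

end

theorem state_ext {s t : State} (h0 : om s 0 = om t 0) (h1 : om s 1 = om t 1)
    (h2 : om s 2 = om t 2) (a0 : al s 0 = al t 0) (a1 : al s 1 = al t 1) (a2 : al s 2 = al t 2)
    (b0 : be s 0 = be t 0) (b1 : be s 1 = be t 1) (b2 : be s 2 = be t 2) : s = t := by
  refine Prod.ext (funext fun i => ?_) (Prod.ext (funext fun i => ?_) (funext fun i => ?_)) <;>
    fin_cases i <;> assumption

/-- The shape of `param` makes α · β = 0 an identity, and 4|α|², 4|β|² are affine functions of
`planarH` with coefficients depending on σ, X and λ only. So membership is a condition on the level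
of `planarH`, not on the individual point. -/
theorem param_mem_phaseSpace_iff {a b lam σ X o₁ o₂ : ℝ} (hlam : lam ≠ 0) (hσ : σ ≠ 0) :
    param lam σ X o₁ o₂ ∈ phaseSpace a b ↔ Compatible a b lam σ X (planarH lam σ X o₁ o₂) := by
  rw [mem_phaseSpace_iff, al_param_zero, al_param_one, al_param_two, be_param_zero, be_param_one,
    be_param_two, Compatible]
  have h3 : (X + (σ * (lam ^ 2 + σ) - X ^ 2) / lam ^ 2
        + (X - (lam ^ 2 + σ)) * (o₁ ^ 2 - o₂ ^ 2) / σ) / 2 * (-(X + (lam ^ 2 + σ)) * (o₁ * o₂) / σ)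
      + (X - (lam ^ 2 + σ)) * (o₁ * o₂) / σ * (((σ * (lam ^ 2 + σ) - X ^ 2) / lam ^ 2 - X
        + (X + (lam ^ 2 + σ)) * (o₁ ^ 2 - o₂ ^ 2) / σ) / 2)
      + ((lam ^ 2 + σ) - X) * o₁ / lam * (((lam ^ 2 + σ) + X) * o₂ / lam) = 0 := by
    field_simp
    ring
  have h1 : 4 * (((X + (σ * (lam ^ 2 + σ) - X ^ 2) / lam ^ 2
        + (X - (lam ^ 2 + σ)) * (o₁ ^ 2 - o₂ ^ 2) / σ) / 2) ^ 2
      + ((X - (lam ^ 2 + σ)) * (o₁ * o₂) / σ) ^ 2 + (((lam ^ 2 + σ) - X) * o₁ / lam) ^ 2)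
      = (X + (σ * (lam ^ 2 + σ) - X ^ 2) / lam ^ 2) ^ 2
        + (lam ^ 2 + σ - X) ^ 2 * planarH lam σ X o₁ o₂ := by
    unfold planarH
    field_simp
    ring
  have h2 : 4 * ((-(X + (lam ^ 2 + σ)) * (o₁ * o₂) / σ) ^ 2
      + (((σ * (lam ^ 2 + σ) - X ^ 2) / lam ^ 2 - X
        + (X + (lam ^ 2 + σ)) * (o₁ ^ 2 - o₂ ^ 2) / σ) / 2) ^ 2
      + (((lam ^ 2 + σ) + X) * o₂ / lam) ^ 2)
      = (X - (σ * (lam ^ 2 + σ) - X ^ 2) / lam ^ 2) ^ 2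
        + (lam ^ 2 + σ + X) ^ 2 * planarH lam σ X o₁ o₂ := by
    unfold planarH
    field_simp
    ring
  rw [← h1, ← h2]
  constructor
  · rintro ⟨e1, e2, -⟩
    exact ⟨by rw [e1], by rw [e2]⟩
  · rintro ⟨e1, e2⟩
    exact ⟨by linarith, by linarith, h3⟩

theorem Compatible.r2_eq {a b lam σ X T : ℝ} (h : Compatible a b lam σ X T) :
    a ^ 2 - b ^ 2 = X * ((σ * (lam ^ 2 + σ) - X ^ 2) / lam ^ 2 - (lam ^ 2 + σ) * T) := by
  linear_combination h.1 / 4 - h.2 / 4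

theorem Compatible.p2_eq {a b lam σ X T : ℝ} (h : Compatible a b lam σ X T) :
    2 * (a ^ 2 + b ^ 2) = X ^ 2 + ((σ * (lam ^ 2 + σ) - X ^ 2) / lam ^ 2) ^ 2
      + ((lam ^ 2 + σ) ^ 2 + X ^ 2) * T := by
  linear_combination h.1 / 2 + h.2 / 2

theorem compatible_of {a b lam σ X T : ℝ}
    (h1 : a ^ 2 - b ^ 2 = X * ((σ * (lam ^ 2 + σ) - X ^ 2) / lam ^ 2 - (lam ^ 2 + σ) * T))
    (h2 : 2 * (a ^ 2 + b ^ 2) = X ^ 2 + ((σ * (lam ^ 2 + σ) - X ^ 2) / lam ^ 2) ^ 2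
      + ((lam ^ 2 + σ) ^ 2 + X ^ 2) * T) : Compatible a b lam σ X T :=
  ⟨by linear_combination h2 + 2 * h1, by linear_combination h2 - 2 * h1⟩

theorem Compatible.ne_zero {a b lam σ X T : ℝ} (hb : 0 < b) (hab : b < a)
    (h : Compatible a b lam σ X T) : X ≠ 0 := by
  rintro rfl
  have := h.r2_eq
  nlinarith

/-- At a point of the parametrized family `dK = 2 σ dH`. -/
theorem dres_K_param {a b lam σ X o₁ o₂ : ℝ} (hb : 0 < b) (hab : b < a) (hlam : lam ≠ 0)
    (hσ : σ ≠ 0) (hs : param lam σ X o₁ o₂ ∈ phaseSpace a b) :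
    dres (K lam) (param lam σ X o₁ o₂) = (2 * σ) • dres H (param lam σ X o₁ o₂) := by
  rw [dres_eq_smul_iff (hb.trans hab).ne' hb.ne' hs]
  intro δ ξ
  rw [fderiv_K, fderiv_H]
  simp only [om_tvec, al_tvec_zero, al_tvec_one, al_tvec_two, be_tvec_zero, be_tvec_one,
    be_tvec_two, om_param_zero, om_param_one, om_param_two, al_param_zero, al_param_one,
    al_param_two, be_param_zero, be_param_one, be_param_two]
  field_simp
  ring

/-- The first step in solving `dK = 2 σ dH`: all variables in terms of the equatorial angular
velocities and of the complex quantity `x₁ + (λ² + σ) w₁² / σ`. -/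
theorem solve_critical {lam σ o₀ o₁ o₂ a₀ a₁ a₂ b₀ b₁ b₂ X Z : ℝ} (hlam : lam ≠ 0) (hσ : σ ≠ 0)
    (hw : o₀ ^ 2 + o₁ ^ 2 ≠ 0) (hX : a₀ - b₁ = X - (lam ^ 2 + σ) * (o₀ ^ 2 - o₁ ^ 2) / σ)
    (hZ : a₁ + b₀ = Z - 2 * (lam ^ 2 + σ) * (o₀ * o₁) / σ)
    (e₂ : lam * (o₀ ^ 2 + o₁ ^ 2) = σ * o₂)
    (e₀ : (o₀ ^ 2 - o₁ ^ 2 + a₀ - b₁) * o₀ + (2 * o₀ * o₁ + a₁ + b₀) * o₁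
      + lam * ((o₂ - lam) * o₀ + a₂) = σ * o₀)
    (e₁ : -(o₀ ^ 2 - o₁ ^ 2 + a₀ - b₁) * o₁ + (2 * o₀ * o₁ + a₁ + b₀) * o₀
      + lam * ((o₂ - lam) * o₁ + b₂) = σ * o₁)
    (f₀ : -(o₀ ^ 2 - o₁ ^ 2 + a₀ - b₁) * b₂ + (2 * o₀ * o₁ + a₁ + b₀) * a₂
      - 2 * lam * (o₀ * a₁ + o₁ * b₁) = -σ * b₂)
    (f₁ : -(o₀ ^ 2 - o₁ ^ 2 + a₀ - b₁) * a₂ - (2 * o₀ * o₁ + a₁ + b₀) * b₂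
      + 2 * lam * (o₀ * a₀ + o₁ * b₀) = σ * a₂) :
    a₂ = ((lam ^ 2 + σ) * o₀ - (o₀ * X + o₁ * Z)) / lam ∧
    b₂ = ((lam ^ 2 + σ) * o₁ - (o₀ * Z - o₁ * X)) / lam ∧
    a₀ + b₁ = (σ * (lam ^ 2 + σ) - (X ^ 2 + Z ^ 2)) / lam ^ 2
      + ((o₀ ^ 2 - o₁ ^ 2) * X + 2 * o₀ * o₁ * Z) / σ ∧
    a₁ - b₀ = (2 * o₀ * o₁ * X - (o₀ ^ 2 - o₁ ^ 2) * Z) / σ := by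
  obtain ⟨P, hP⟩ : ∃ P, P = a₀ + b₁ := ⟨_, rfl⟩
  obtain ⟨R, hR⟩ : ∃ R, R = a₁ - b₀ := ⟨_, rfl⟩
  have ho₂ : o₂ = lam / σ * (o₀ ^ 2 + o₁ ^ 2) := by field_simp; linarith
  have ha₀ : a₀ = (P + (X - (lam ^ 2 + σ) * (o₀ ^ 2 - o₁ ^ 2) / σ)) / 2 := by linarith
  have hb₁ : b₁ = (P - (X - (lam ^ 2 + σ) * (o₀ ^ 2 - o₁ ^ 2) / σ)) / 2 := by linarith
  have ha₁ : a₁ = (R + (Z - 2 * (lam ^ 2 + σ) * (o₀ * o₁) / σ)) / 2 := by linarith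
  have hb₀ : b₀ = ((Z - 2 * (lam ^ 2 + σ) * (o₀ * o₁) / σ) - R) / 2 := by linarith
  rw [← hP, ← hR]
  clear hX hZ hP hR e₂
  subst ho₂ ha₀ hb₁ ha₁ hb₀
  -- The equations e₀, e₁ are linear in α₃, β₃. With ζ = X + iZ they read λz₁ = (λ² + σ) w₁ - ζ w₂.
  have ha₂ : a₂ = ((lam ^ 2 + σ) * o₀ - (o₀ * X + o₁ * Z)) / lam := by
    field_simp at e₀ ⊢
    apply mul_left_cancel₀ hσ
    linear_combination e₀ / 2
  have hb₂ : b₂ = ((lam ^ 2 + σ) * o₁ - (o₀ * Z - o₁ * X)) / lam := by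
    field_simp at e₁ ⊢
    apply mul_left_cancel₀ hσ
    linear_combination e₁ / 2
  -- After inserting z₁, the combinations of f₀, f₁ with coefficients o₀, o₁ separate the real and
  -- imaginary parts of y₁, each with the nonzero factor o₀² + o₁². In complex form λ²y₁ = σ(λ² + σ)
  -- - |ζ|² + λ²ζ̄w₁²/σ.
  refine ⟨ha₂, hb₂, ?_, ?_⟩
  · clear e₀ e₁
    subst ha₂ hb₂
    field_simp at f₀ f₁ ⊢
    apply mul_left_cancel₀ hw
    linear_combination (o₀ * f₁ - o₁ * f₀) / 2
  · clear e₀ e₁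
    subst ha₂ hb₂
    field_simp at f₀ f₁ ⊢
    apply mul_left_cancel₀ (mul_ne_zero (pow_ne_zero 2 hlam) hw)
    linear_combination -(o₀ * f₀ + o₁ * f₁) / 2

end KowalevskiGyrostat

end

/-! ### Proportionality of dG and dH, and the solution of dK = c dH -/

noncomputable section

namespace KowalevskiGyrostat

/-- At a point of the parametrized family `dG` is proportional to `dH`. -/
theorem exists_dres_G_param {a b lam σ X o₁ o₂ : ℝ} (hb : 0 < b) (hab : b < a) (hlam : lam ≠ 0)
    (hσ : σ ≠ 0) (hs : param lam σ X o₁ o₂ ∈ phaseSpace a b) :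
    ∃ c : ℝ, dres (G a b lam) (param lam σ X o₁ o₂) = c • dres H (param lam σ X o₁ o₂) := by
  obtain ⟨Y, hY⟩ : ∃ Y, Y = (σ * (lam ^ 2 + σ) - X ^ 2) / lam ^ 2 := ⟨_, rfl⟩
  obtain ⟨h1, h2⟩ := (param_mem_phaseSpace_iff hlam hσ).1 hs
  -- The multiplier depends on the point only through `planarH`, so it is constant along a level.
  refine ⟨(X ^ 2 + Y ^ 2) / 4 + (lam ^ 2 + σ) * Y / 2
    + (X ^ 2 - (lam ^ 2 + σ) ^ 2) / 4 * planarH lam σ X o₁ o₂, ?_⟩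
  rw [dres_eq_smul_iff (hb.trans hab).ne' hb.ne' hs]
  intro δ ξ
  -- The function G contains a² and b² explicitly; the proportionality becomes an algebraic identity
  -- only after they are replaced by their values on the family.
  have ha' : a ^ 2 = ((X + (σ * (lam ^ 2 + σ) - X ^ 2) / lam ^ 2) ^ 2
    + (lam ^ 2 + σ - X) ^ 2 * planarH lam σ X o₁ o₂) / 4 := by linarith
  have hb' : b ^ 2 = ((X - (σ * (lam ^ 2 + σ) - X ^ 2) / lam ^ 2) ^ 2
    + (lam ^ 2 + σ + X) ^ 2 * planarH lam σ X o₁ o₂) / 4 := by linarith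
  rw [fderiv_G, fderiv_H, ha', hb', hY]
  generalize δ 0 = d0
  simp only [om_tvec, al_tvec_zero, al_tvec_one, al_tvec_two, be_tvec_zero, be_tvec_one,
    be_tvec_two, om_param_zero, om_param_one, om_param_two, al_param_zero, al_param_one,
    al_param_two, be_param_zero, be_param_one, be_param_two, planarH]
  field_simp
  ring

/-- The points of the pendulum motions. -/
def IsPlanar (s : State) : Prop := om s 0 = 0 ∧ om s 1 = 0 ∧ al s 2 = 0 ∧ be s 2 = 0

/-- In the plane orthogonal to the third axis `β` is obtained from `α` by a rotation by `± π / 2`. -/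
theorem IsPlanar.exists_sign {a b : ℝ} (hb : 0 < b) (hab : b < a) {s : State}
    (hs : s ∈ phaseSpace a b) (h : IsPlanar s) : ∃ e : ℝ, (e = 1 ∨ e = -1) ∧
      be s 0 = -(e * (b / a) * al s 1) ∧ be s 1 = e * (b / a) * al s 0 := by
  obtain ⟨g1, g2, g3⟩ := mem_phaseSpace_iff.1 hs
  obtain ⟨-, -, ha2, hb2⟩ := h
  have ha : 0 < a := hb.trans hab
  rw [ha2] at g1 g3
  rw [hb2] at g2
  -- The sign e is the third component of α × β divided by ab: its square is 1 because α, β are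
  -- orthogonal vectors of the equatorial plane.
  have hsq : ((al s 0 * be s 1 - al s 1 * be s 0) / (a * b)) ^ 2 = 1 := by
    rw [div_pow, div_eq_one_iff_eq (by positivity), mul_pow]
    linear_combination (be s 0 ^ 2 + be s 1 ^ 2) * g1 + a ^ 2 * g2
      - (al s 0 * be s 0 + al s 1 * be s 1) * g3
  refine ⟨_, mul_self_eq_one_iff.1 ((sq _).symm.trans hsq), ?_, ?_⟩
  · field_simp
    linear_combination -be s 0 * g1 + al s 0 * g3
  · field_simp
    linear_combination -be s 1 * g1 + al s 1 * g3

/-- To first order K equals |x₁|² here: all other terms contain products of two of the vanishing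
quantities ω₁, ω₂, α₃, β₃. Tilting the axis does not change x₁ to first order, and a rotation about
the axis only rotates x₁. -/
theorem IsPlanar.dres_K {a b : ℝ} (hb : 0 < b) (hab : b < a) {s : State}
    (hs : s ∈ phaseSpace a b) (h : IsPlanar s) (lam : ℝ) :
    dres (K lam) s = (0 : ℝ) • dres H s := by
  rw [dres_eq_smul_iff (hb.trans hab).ne' hb.ne' hs]
  intro δ ξ
  obtain ⟨h0, h1, h2, h3⟩ := h
  rw [fderiv_K]
  simp only [om_tvec, al_tvec_zero, al_tvec_one, al_tvec_two, be_tvec_zero, be_tvec_one,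
    be_tvec_two, h0, h1, h2, h3]
  ring

theorem IsPlanar.exists_dres_G {a b : ℝ} (hb : 0 < b) (hab : b < a) {s : State}
    (hs : s ∈ phaseSpace a b) (h : IsPlanar s) (lam : ℝ) :
    ∃ c : ℝ, dres (G a b lam) s = c • dres H s := by
  obtain ⟨e, he, e0, e1⟩ := h.exists_sign hb hab hs
  have ha : 0 < a := hb.trans hab
  have he2 : e ^ 2 = 1 := by rcases he with rfl | rfl <;> norm_num
  obtain ⟨g1, -, -⟩ := mem_phaseSpace_iff.1 hs
  obtain ⟨h0, h1, h2, h3⟩ := h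
  -- The multiplier is the third component of α × β.
  refine ⟨e * a * b, ?_⟩
  rw [dres_eq_smul_iff ha.ne' hb.ne' hs]
  intro δ ξ
  rw [fderiv_G, fderiv_H]
  simp only [om_tvec, al_tvec_zero, al_tvec_one, al_tvec_two, be_tvec_zero, be_tvec_one,
    be_tvec_two, h0, h1, h2, h3, e0, e1]
  rw [h2] at g1
  field_simp
  linear_combination (2 * a * b * e * om s 2 * δ 2) * g1 + 2 * a ^ 2 * b ^ 2 * al s 1 * ξ 2 * he2

/-- The geometric integrals force `x₁ + (λ² + σ) w₁² / σ` to be real. -/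
theorem imaginary_part_eq_zero {lam σ o₀ o₁ D₁ D₂ S₁ S₂ a₂ b₂ X Z R : ℝ} (hlam : lam ≠ 0)
    (hσ : σ ≠ 0) (hR : R ≠ 0) (h₁ : D₁ = X - (lam ^ 2 + σ) * (o₀ ^ 2 - o₁ ^ 2) / σ)
    (h₂ : D₂ = Z - 2 * (lam ^ 2 + σ) * (o₀ * o₁) / σ)
    (r₁ : a₂ = ((lam ^ 2 + σ) * o₀ - (o₀ * X + o₁ * Z)) / lam)
    (r₂ : b₂ = ((lam ^ 2 + σ) * o₁ - (o₀ * Z - o₁ * X)) / lam)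
    (r₃ : S₁ = (σ * (lam ^ 2 + σ) - (X ^ 2 + Z ^ 2)) / lam ^ 2
      + ((o₀ ^ 2 - o₁ ^ 2) * X + 2 * o₀ * o₁ * Z) / σ)
    (r₄ : S₂ = (2 * o₀ * o₁ * X - (o₀ ^ 2 - o₁ ^ 2) * Z) / σ)
    (hre : a₂ ^ 2 - b₂ ^ 2 + D₁ * S₁ + D₂ * S₂ = R)
    (him : 2 * a₂ * b₂ + D₂ * S₁ - D₁ * S₂ = 0) : Z = 0 := by
  -- The hypotheses `hre` and `him` are the real and imaginary parts of z₁² + x₁y₂ = R. The left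
  -- side is ζB with ζ = X + iZ and this real B; as R ≠ 0 is real, B ≠ 0 and Z = 0.
  obtain ⟨B, hB⟩ : ∃ B, B = -2 * (lam ^ 2 + σ) * (o₀ ^ 2 + o₁ ^ 2) / lam ^ 2
      + 2 * (lam ^ 2 + σ) * ((o₀ ^ 2 - o₁ ^ 2) * X + 2 * o₀ * o₁ * Z) / (lam ^ 2 * σ)
      + σ * (lam ^ 2 + σ) / lam ^ 2 - (X ^ 2 + Z ^ 2) / lam ^ 2
      - (lam ^ 2 + σ) * (o₀ ^ 2 + o₁ ^ 2) ^ 2 / σ ^ 2 := ⟨_, rfl⟩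
  have hre' : X * B = R := by
    rw [← hre, r₁, r₂, r₃, r₄, h₁, h₂, hB]
    field_simp
    ring
  have him' : Z * B = 0 := by
    rw [← him, r₁, r₂, r₃, r₄, h₁, h₂, hB]
    field_simp
    ring
  refine (mul_eq_zero.1 him').resolve_right ?_
  rintro h
  rw [h, mul_zero] at hre'
  exact hR hre'.symm

/-- The components of the equation `dK = c dH`. -/
theorem critical_equations {a b lam c : ℝ} (ha : a ≠ 0) (hb : b ≠ 0) {s : State}
    (hs : s ∈ phaseSpace a b) (hK : dres (K lam) s = c • dres H s) :
    2 * lam * (om s 0 ^ 2 + om s 1 ^ 2) = c * om s 2 ∧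
    (om s 0 ^ 2 - om s 1 ^ 2 + al s 0 - be s 1) * om s 0
      + (2 * om s 0 * om s 1 + al s 1 + be s 0) * om s 1
      + lam * ((om s 2 - lam) * om s 0 + al s 2) = c / 2 * om s 0 ∧
    -(om s 0 ^ 2 - om s 1 ^ 2 + al s 0 - be s 1) * om s 1
      + (2 * om s 0 * om s 1 + al s 1 + be s 0) * om s 0
      + lam * ((om s 2 - lam) * om s 1 + be s 2) = c / 2 * om s 1 ∧
    -(om s 0 ^ 2 - om s 1 ^ 2 + al s 0 - be s 1) * be s 2
      + (2 * om s 0 * om s 1 + al s 1 + be s 0) * al s 2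
      - 2 * lam * (om s 0 * al s 1 + om s 1 * be s 1) = -(c / 2) * be s 2 ∧
    -(om s 0 ^ 2 - om s 1 ^ 2 + al s 0 - be s 1) * al s 2
      - (2 * om s 0 * om s 1 + al s 1 + be s 0) * be s 2
      + 2 * lam * (om s 0 * al s 0 + om s 1 * be s 0) = c / 2 * al s 2 := by
  rw [dres_eq_smul_iff ha hb hs] at hK
  simp only [fderiv_K, fderiv_H, om_tvec, al_tvec_zero, al_tvec_one, al_tvec_two, be_tvec_zero,
    be_tvec_one, be_tvec_two] at hK
  -- Three variations of ω and the rotations about the first two axes suffice to determine the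
  -- point; the equation from the third axis is not used.
  have e0 := hK ![1, 0, 0] 0
  have e1 := hK ![0, 1, 0] 0
  have e2 := hK ![0, 0, 1] 0
  have f0 := hK 0 ![1, 0, 0]
  have f1 := hK 0 ![0, 1, 0]
  clear hK
  simp only [Matrix.cons_val_zero, Matrix.cons_val_one, Matrix.cons_val, Pi.zero_apply, mul_zero,
    mul_one, sub_zero, zero_sub, add_zero, zero_add, zero_mul] at e0 e1 e2 f0 f1
  exact ⟨by linear_combination e2, by linear_combination e0 / 4, by linear_combination e1 / 4,
    by linear_combination f0 / 2, by linear_combination f1 / 2⟩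

/-- The points of the phase space at which `dK` is proportional to `dH`. -/
theorem planar_or_param {a b lam c : ℝ} (hb : 0 < b) (hab : b < a) (hlam : lam ≠ 0) {s : State}
    (hs : s ∈ phaseSpace a b) (hK : dres (K lam) s = c • dres H s) :
    IsPlanar s ∨ ∃ σ X, σ ≠ 0 ∧ om s 0 ^ 2 + om s 1 ^ 2 ≠ 0 ∧
      s = param lam σ X (om s 0) (om s 1) := by
  obtain ⟨e2, e0, e1, f0, f1⟩ := critical_equations (hb.trans hab).ne' hb.ne' hs hK
  obtain ⟨g1, g2, g3⟩ := mem_phaseSpace_iff.1 hs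
  by_cases hw : om s 0 ^ 2 + om s 1 ^ 2 = 0
  · left
    have h0 : om s 0 = 0 := by nlinarith [sq_nonneg (om s 0), sq_nonneg (om s 1)]
    have h1 : om s 1 = 0 := by nlinarith [sq_nonneg (om s 0), sq_nonneg (om s 1)]
    rw [h0, h1] at e0 e1
    have hα : lam * al s 2 = 0 := by linarith
    have hβ : lam * be s 2 = 0 := by linarith
    exact ⟨h0, h1, (mul_eq_zero.1 hα).resolve_left hlam, (mul_eq_zero.1 hβ).resolve_left hlam⟩
  · right
    obtain ⟨σ, rfl⟩ : ∃ σ, c = 2 * σ := ⟨c / 2, by ring⟩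
    rw [mul_div_cancel_left₀ σ two_ne_zero] at e0 e1 f0 f1
    have hσ : σ ≠ 0 := by
      rintro rfl
      exact mul_ne_zero hlam hw (by linarith)
    obtain ⟨X, hX⟩ : ∃ X, X = al s 0 - be s 1
      + (lam ^ 2 + σ) * (om s 0 ^ 2 - om s 1 ^ 2) / σ := ⟨_, rfl⟩
    obtain ⟨Z, hZ⟩ : ∃ Z, Z = al s 1 + be s 0 + 2 * (lam ^ 2 + σ) * (om s 0 * om s 1) / σ :=
      ⟨_, rfl⟩
    have hX' : al s 0 - be s 1 = X - (lam ^ 2 + σ) * (om s 0 ^ 2 - om s 1 ^ 2) / σ := by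
      rw [hX]; ring
    have hZ' : al s 1 + be s 0 = Z - 2 * (lam ^ 2 + σ) * (om s 0 * om s 1) / σ := by
      rw [hZ]; ring
    clear hX hZ
    have e2' : lam * (om s 0 ^ 2 + om s 1 ^ 2) = σ * om s 2 := by linear_combination e2 / 2
    obtain ⟨r1, r2, r3, r4⟩ := solve_critical hlam hσ hw hX' hZ' e2' e0 e1 f0 f1
    have hre : al s 2 ^ 2 - be s 2 ^ 2 + (al s 0 - be s 1) * (al s 0 + be s 1)
        + (al s 1 + be s 0) * (al s 1 - be s 0) = a ^ 2 - b ^ 2 := by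
      linear_combination g1 - g2
    have him : 2 * al s 2 * be s 2 + (al s 1 + be s 0) * (al s 0 + be s 1)
        - (al s 0 - be s 1) * (al s 1 - be s 0) = 0 := by
      linear_combination 2 * g3
    have hR : a ^ 2 - b ^ 2 ≠ 0 := by
      have : 0 < (a - b) * (a + b) := mul_pos (by linarith) (by linarith)
      exact fun h => this.ne' (by linear_combination h)
    have hZ0 : Z = 0 := imaginary_part_eq_zero hlam hσ hR
      hX' hZ' r1 r2 r3 r4 hre him
    subst hZ0
    refine ⟨σ, X, hσ, hw, state_ext rfl rfl ?_ ?_ ?_ ?_ ?_ ?_ ?_⟩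
    · rw [om_param_two]; field_simp; linear_combination -e2'
    · rw [al_param_zero]; linear_combination (r3 + hX') / 2
    · rw [al_param_one]; linear_combination (r4 + hZ') / 2
    · rw [al_param_two, r1]; ring
    · rw [be_param_zero]; linear_combination (hZ' - r4) / 2
    · rw [be_param_one]; linear_combination (r3 - hX') / 2
    · rw [be_param_two, r2]; ring

end KowalevskiGyrostat

end

noncomputable section

namespace KowalevskiGyrostat

/-! ### The explicit formulas of the second family -/

theorem r2_pos {a b : ℝ} (hb : 0 < b) (hab : b < a) : 0 < r2 a b := by
  unfold r2
  nlinarith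

theorem Quintic.ne_zero {a b lam σ u : ℝ} (hb : 0 < b) (hab : b < a) (hlam : lam ≠ 0) (hσ : σ ≠ 0)
    (h : Quintic a b lam σ u) : u ≠ 0 := by
  rintro rfl
  have h2 : r2 a b ^ 4 * lam ^ 8 * σ ^ 6 = 0 := by
    unfold Quintic at h
    linear_combination -h
  exact mul_ne_zero (mul_ne_zero (pow_ne_zero 4 (r2_pos hb hab).ne') (pow_ne_zero 8 hlam))
    (pow_ne_zero 6 hσ) h2

/-- The quintic is the result of eliminating T from the relations for r² and p², with u in place of
X. Substituting both relations turns it into an identity in σ, X, T and λ. -/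
theorem Compatible.quintic {a b lam σ X T : ℝ} (hb : 0 < b) (hab : b < a) (hlam : lam ≠ 0)
    (h : Compatible a b lam σ X T) : Quintic a b lam σ (r2 a b * lam ^ 2 * σ / X) := by
  have hX := h.ne_zero hb hab
  have h1 : r2 a b = X * ((σ * (lam ^ 2 + σ) - X ^ 2) / lam ^ 2 - (lam ^ 2 + σ) * T) := h.r2_eq
  have h2 : p2 a b = (X ^ 2 + ((σ * (lam ^ 2 + σ) - X ^ 2) / lam ^ 2) ^ 2
      + ((lam ^ 2 + σ) ^ 2 + X ^ 2) * T) / 2 := by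
    have := h.p2_eq
    unfold p2
    linarith
  have hu : r2 a b * lam ^ 2 * σ / X
      = ((σ * (lam ^ 2 + σ) - X ^ 2) - lam ^ 2 * (lam ^ 2 + σ) * T) * σ := by
    rw [h1]
    field_simp
  unfold Quintic
  rw [hu, h1, h2]
  field_simp
  ring

/-- In the relation for p² the coefficient of T is (λ² + σ)² + X², which is positive since X ≠ 0.
This also covers σ = -λ², where the relation for r² does not determine T. -/
theorem Compatible.unique {a b lam σ X T T' : ℝ} (hb : 0 < b) (hab : b < a)
    (h : Compatible a b lam σ X T) (h' : Compatible a b lam σ X T') : T = T' := by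
  have hX := h.ne_zero hb hab
  have h1 : ((lam ^ 2 + σ) ^ 2 + X ^ 2) * (T - T') = 0 := by
    linear_combination h'.p2_eq - h.p2_eq
  have h2 : (lam ^ 2 + σ) ^ 2 + X ^ 2 ≠ 0 := by positivity
  linarith [(mul_eq_zero.1 h1).resolve_left h2]

/-- For σ ≠ -λ² the value of T is the one solving the relation for r², and the quintic is the
relation for p² cleared of denominators. For σ = -λ² the roles change: T drops out of the relation
for r², which is now the quintic, and the limit value in `Pconst` is the T solving the relation for
p². -/
theorem Quintic.compatible {a b lam σ u : ℝ} (hb : 0 < b) (hab : b < a) (hlam : lam ≠ 0)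
    (hσ : σ ≠ 0) (h : Quintic a b lam σ u) :
    Compatible a b lam σ (r2 a b * lam ^ 2 * σ / u) (-(Pconst a b lam σ u) / σ ^ 2) := by
  have hu := h.ne_zero hb hab hlam hσ
  have hr := (r2_pos hb hab).ne'
  unfold Quintic at h
  unfold Pconst
  split_ifs with hm
  · obtain rfl : σ = -lam ^ 2 := by linarith
    -- At σ = -λ² all terms of the quintic with the factor λ² + σ vanish, and the other two factor.
    have h3 : u ^ 3 = r2 a b ^ 2 * lam ^ 10 := by
      have : r2 a b ^ 2 * lam ^ 10 * (u ^ 3 - r2 a b ^ 2 * lam ^ 10) = 0 := by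
        linear_combination h
      have hne : r2 a b ^ 2 * lam ^ 10 ≠ 0 := mul_ne_zero (pow_ne_zero 2 hr) (pow_ne_zero 10 hlam)
      linarith [(mul_eq_zero.1 this).resolve_left hne]
    apply compatible_of
    · change r2 a b = _
      field_simp
      ring_nf
      rw [h3]
      ring
    · change 2 * p2 a b = _
      field_simp
      linear_combination (2 * p2 a b * u) * h3
  · apply compatible_of
    · change r2 a b = _
      field_simp
      ring
    · change 2 * p2 a b = _
      have key : σ * u ^ 4 * (lam ^ 2 + σ) * lam ^ 4 * (2 * p2 a b) = σ * u ^ 4 * (lam ^ 2 + σ)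
          * lam ^ 4 * ((r2 a b * lam ^ 2 * σ / u) ^ 2 + ((σ * (lam ^ 2 + σ)
            - (r2 a b * lam ^ 2 * σ / u) ^ 2) / lam ^ 2) ^ 2 + ((lam ^ 2 + σ) ^ 2
            + (r2 a b * lam ^ 2 * σ / u) ^ 2) * (-(σ * (u ^ 3 - (lam ^ 2 + σ) * σ ^ 2 * u ^ 2
            + r2 a b ^ 2 * lam ^ 4 * σ ^ 3) / ((lam ^ 2 + σ) * lam ^ 2 * u ^ 2)) / σ ^ 2)) := by
        rw [← sub_eq_zero, ← h]
        field_simp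
        ring
      exact mul_left_cancel₀ (by positivity) key

/-- Written through `Pconst`, the generic and the exceptional definition of Q have the same form, so
σ = -λ² needs no separate treatment afterwards. -/
theorem Q_mul {a b lam σ u w : ℝ} (hr : r2 a b ≠ 0) (hlam : lam ≠ 0) (hσ : σ ≠ 0) (hu : u ≠ 0)
    (hw : w ≠ 0) : Q a b lam σ u w * w =
      (lam ^ 2 * w ^ 2 + 2 * σ ^ 2 * w + lam ^ 2 * Pconst a b lam σ u) * u
        / (2 * r2 a b * lam ^ 2 * σ ^ 2) := by
  unfold Q Pconst
  split_ifs with hm <;> field_simp <;> ring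

/-- The quadratic relation for `q ^ 2` expresses the value of the planar Hamiltonian. -/
theorem Q_mul_eq_iff {a b lam σ u o₁ o₂ : ℝ} (hr : r2 a b ≠ 0) (hlam : lam ≠ 0) (hσ : σ ≠ 0)
    (hu : u ≠ 0) (hw : o₁ ^ 2 + o₂ ^ 2 ≠ 0) :
    Q a b lam σ u (o₁ ^ 2 + o₂ ^ 2) * (o₁ ^ 2 + o₂ ^ 2) = o₁ ^ 2 - o₂ ^ 2 ↔
      planarH lam σ (r2 a b * lam ^ 2 * σ / u) o₁ o₂ = -(Pconst a b lam σ u) / σ ^ 2 := by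
  rw [Q_mul hr hlam hσ hu hw, planarH]
  constructor
  · intro h
    field_simp at h ⊢
    linear_combination h
  · intro h
    field_simp at h ⊢
    linear_combination h

section complex

variable {lam σ u w X R : ℝ} {q : ℂ} {s : State}

/-- The right-hand sides of the explicit formulas in terms of `w₁`, `w₂`. -/
theorem formulas_eq (hlam : lam ≠ 0) (hσ : σ ≠ 0) (hu : u ≠ 0) (hw : 0 < w) (hq : q ≠ 0)
    (hX : X = R * lam ^ 2 * σ / u) (h₁ : w1 s = q * (√w : ℝ)) (h₂ : w2 s = (√w : ℝ) / q) :
    1 / ((σ : ℂ) * u) * (R * lam ^ 2 * σ ^ 2 - (lam ^ 2 + σ) * u * q ^ 2 * w)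
      = X - (lam ^ 2 + σ) / σ * w1 s ^ 2 ∧
    1 / ((σ : ℂ) * u) * (R * lam ^ 2 * σ ^ 2 - (lam ^ 2 + σ) * u * (w / q ^ 2))
      = X - (lam ^ 2 + σ) / σ * w2 s ^ 2 ∧
    (σ : ℂ) * (1 + σ / lam ^ 2 - R ^ 2 * lam ^ 2 * σ / u ^ 2) + R * lam ^ 2 / u * q ^ 2 * w
      = (σ * (lam ^ 2 + σ) - X ^ 2) / lam ^ 2 + X / σ * w1 s ^ 2 ∧
    (σ : ℂ) * (1 + σ / lam ^ 2 - R ^ 2 * lam ^ 2 * σ / u ^ 2) + R * lam ^ 2 / u * (w / q ^ 2)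
      = (σ * (lam ^ 2 + σ) - X ^ 2) / lam ^ 2 + X / σ * w2 s ^ 2 ∧
    -((R : ℂ) * lam * σ / u) * ((√w : ℝ) / q) + ((lam : ℂ) ^ 2 + σ) / lam * q * (√w : ℝ)
      = -(X / lam) * w2 s + (lam ^ 2 + σ) / lam * w1 s ∧
    -((R : ℂ) * lam * σ / u) * q * (√w : ℝ) + ((lam : ℂ) ^ 2 + σ) / lam * ((√w : ℝ) / q)
      = -(X / lam) * w1 s + (lam ^ 2 + σ) / lam * w2 s := by
  have hw2 : ((√w : ℝ) : ℂ) ^ 2 = w := by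
    rw [← Complex.ofReal_pow, Real.sq_sqrt hw.le]
  have hlam' : (lam : ℂ) ≠ 0 := by exact_mod_cast hlam
  have hσ' : (σ : ℂ) ≠ 0 := by exact_mod_cast hσ
  have hu' : (u : ℂ) ≠ 0 := by exact_mod_cast hu
  subst hX
  rw [h₁, h₂, ← hw2]
  push_cast
  refine ⟨?_, ?_, ?_, ?_, ?_, ?_⟩ <;> field_simp

theorem w1_mul_w2 (s : State) : w1 s * w2 s = ((om s 0 ^ 2 + om s 1 ^ 2 : ℝ) : ℂ) := by
  apply Complex.ext
  · simp only [w1, w2, Complex.mul_re, Complex.ofReal_re]; ring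
  · simp only [w1, w2, Complex.mul_im, Complex.ofReal_im]; ring

theorem w1_sq_add_w2_sq (s : State) :
    w1 s ^ 2 + w2 s ^ 2 = ((2 * (om s 0 ^ 2 - om s 1 ^ 2) : ℝ) : ℂ) := by
  apply Complex.ext
  · simp only [w1, w2, sq, Complex.add_re, Complex.mul_re, Complex.ofReal_re]; ring
  · simp only [w1, w2, sq, Complex.add_im, Complex.mul_im, Complex.ofReal_im]; ring

end complex

theorem SecondFormulas.q_ne_zero {a b lam σ u w : ℝ} {q : ℂ} {s : State}
    (h : SecondFormulas a b lam σ u w q s) : q ≠ 0 := by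
  rintro rfl
  simpa using h.2.1

/-- Divided by q², the equation is q² + q⁻² = 2c, while w (q² + q⁻²) = w₁² + w₂² = 2 (ω₁² - ω₂²). -/
theorem quadratic_iff {w c : ℝ} {q : ℂ} {s : State} (hq : q ≠ 0) (hw : 0 < w)
    (h₁ : w1 s = q * (√w : ℝ)) (h₂ : w2 s = (√w : ℝ) / q) :
    q ^ 4 - 2 * (c : ℂ) * q ^ 2 + 1 = 0 ↔ c * w = om s 0 ^ 2 - om s 1 ^ 2 := by
  have hw2 : ((√w : ℝ) : ℂ) ^ 2 = w := by
    rw [← Complex.ofReal_pow, Real.sq_sqrt hw.le]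
  have hw' : (w : ℂ) ≠ 0 := by exact_mod_cast hw.ne'
  have h3 := w1_sq_add_w2_sq s
  rw [h₁, h₂, mul_pow, div_pow, hw2] at h3
  have h4 : (w : ℂ) * (q ^ 4 - 2 * (c : ℂ) * q ^ 2 + 1)
      = q ^ 2 * (((2 * (om s 0 ^ 2 - om s 1 ^ 2) - 2 * (c * w) : ℝ)) : ℂ) := by
    rw [Complex.ofReal_sub, ← h3]
    push_cast
    field_simp
    ring
  constructor
  · intro h
    rw [h, mul_zero] at h4
    have h5 := (mul_eq_zero.1 h4.symm).resolve_left (pow_ne_zero 2 hq)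
    have h6 : 2 * (om s 0 ^ 2 - om s 1 ^ 2) - 2 * (c * w) = 0 := by exact_mod_cast h5
    linarith
  · intro h
    rw [h, sub_self, Complex.ofReal_zero, mul_zero] at h4
    exact (mul_eq_zero.1 h4).resolve_left hw'

/-- A point given by the explicit formulas belongs to the parametrized family. -/
theorem SecondFormulas.eq_param {a b lam σ u w : ℝ} {q : ℂ} {s : State} (hb : 0 < b)
    (hab : b < a) (hlam : lam ≠ 0) (hσ : σ ≠ 0) (hQ : Quintic a b lam σ u)
    (h : SecondFormulas a b lam σ u w q s) :
    w = om s 0 ^ 2 + om s 1 ^ 2 ∧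
    s = param lam σ (r2 a b * lam ^ 2 * σ / u) (om s 0) (om s 1) ∧
    planarH lam σ (r2 a b * lam ^ 2 * σ / u) (om s 0) (om s 1) = -(Pconst a b lam σ u) / σ ^ 2 := by
  have hq := h.q_ne_zero
  have hu := hQ.ne_zero hb hab hlam hσ
  -- The formulas for x₂, y₂, z₂ are dropped: for a real state x₁, y₁, z₁ and ω already determine
  -- everything.
  obtain ⟨hw, hqq, h₁, h₂, h₃, hx, -, hy, -, hz, -⟩ := h
  have hw2 : ((√w : ℝ) : ℂ) ^ 2 = w := by
    rw [← Complex.ofReal_pow, Real.sq_sqrt hw.le]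
  have hwo : w = om s 0 ^ 2 + om s 1 ^ 2 := by
    have h3 := w1_mul_w2 s
    rw [h₁, h₂, show q * (√w : ℝ) * ((√w : ℝ) / q) = ((√w : ℝ) : ℂ) ^ 2 by field_simp, hw2] at h3
    exact_mod_cast h3
  have hqq' := (quadratic_iff hq hw h₁ h₂).1 hqq
  obtain ⟨X, hX⟩ : ∃ X, X = r2 a b * lam ^ 2 * σ / u := ⟨_, rfl⟩
  obtain ⟨fx, -, fy, -, fz, -⟩ := formulas_eq hlam hσ hu hw hq hX h₁ h₂
  rw [fx] at hx
  rw [fy] at hy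
  rw [fz] at hz
  refine ⟨hwo, ?_, ?_⟩
  · rw [← hX]
    replace hx : x1 s = (X : ℝ) - (((lam ^ 2 + σ) / σ : ℝ) : ℂ) * w1 s ^ 2 := by
      rw [hx]; push_cast; ring
    replace hy : y1 s = (((σ * (lam ^ 2 + σ) - X ^ 2) / lam ^ 2 : ℝ) : ℂ)
        + ((X / σ : ℝ) : ℂ) * w1 s ^ 2 := by
      rw [hy]; push_cast; ring
    replace hz : z1 s = ((-(X / lam) : ℝ) : ℂ) * w2 s
        + (((lam ^ 2 + σ) / lam : ℝ) : ℂ) * w1 s := by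
      rw [hz]; push_cast; ring
    replace h₃ : w3 s = ((lam / σ * w : ℝ) : ℂ) := by
      rw [h₃]; push_cast; ring
    have hxr := congrArg Complex.re hx
    have hxi := congrArg Complex.im hx
    have hyr := congrArg Complex.re hy
    have hyi := congrArg Complex.im hy
    have hzr := congrArg Complex.re hz
    have hzi := congrArg Complex.im hz
    have hw3 := congrArg Complex.re h₃
    simp only [x1, y1, z1, w1, w2, w3, sq, Complex.add_re, Complex.sub_re, Complex.mul_re,
      Complex.ofReal_re, Complex.add_im, Complex.sub_im, Complex.mul_im, Complex.ofReal_im]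
      at hxr hxi hyr hyi hzr hzi hw3
    refine state_ext rfl rfl ?_ ?_ ?_ ?_ ?_ ?_ ?_
    · rw [om_param_two, hw3, hwo]
    · rw [al_param_zero]; linear_combination (hxr + hyr) / 2
    · rw [al_param_one]; linear_combination (hxi + hyi) / 2
    · rw [al_param_two, hzr]; ring
    · rw [be_param_zero]; linear_combination (hxi - hyi) / 2
    · rw [be_param_one]; linear_combination (hyr - hxr) / 2
    · rw [be_param_two, hzi]; ring
  · rw [hwo] at hqq'
    exact (Q_mul_eq_iff (r2_pos hb hab).ne' hlam hσ hu (hwo ▸ hw.ne')).1 hqq'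

/-- A compatible point of the parametrized family is given by the explicit formulas. -/
theorem secondFormulas_param {a b lam σ u o₁ o₂ : ℝ} (hb : 0 < b) (hab : b < a) (hlam : lam ≠ 0)
    (hσ : σ ≠ 0) (hu : u ≠ 0) (hw : 0 < o₁ ^ 2 + o₂ ^ 2)
    (hT : planarH lam σ (r2 a b * lam ^ 2 * σ / u) o₁ o₂ = -(Pconst a b lam σ u) / σ ^ 2) :
    SecondFormulas a b lam σ u (o₁ ^ 2 + o₂ ^ 2) ((⟨o₁, o₂⟩ : ℂ) / (√(o₁ ^ 2 + o₂ ^ 2) : ℝ))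
      (param lam σ (r2 a b * lam ^ 2 * σ / u) o₁ o₂) := by
  obtain ⟨X, hX⟩ : ∃ X, X = r2 a b * lam ^ 2 * σ / u := ⟨_, rfl⟩
  rw [← hX]
  obtain ⟨w, hwdef⟩ : ∃ w, w = o₁ ^ 2 + o₂ ^ 2 := ⟨_, rfl⟩
  have hrw : ((√w : ℝ) : ℂ) ≠ 0 := by
    rw [hwdef]
    exact_mod_cast (Real.sqrt_pos.2 hw).ne'
  have hw2 : ((√w : ℝ) : ℂ) ^ 2 = w := by
    rw [← Complex.ofReal_pow, Real.sq_sqrt (hwdef ▸ hw.le)]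
  have hne : (⟨o₁, o₂⟩ : ℂ) ≠ 0 := by
    intro h
    rw [Complex.ext_iff] at h
    simp only [Complex.zero_re, Complex.zero_im] at h
    rw [h.1, h.2] at hw
    norm_num at hw
  rw [← hwdef]
  set s := param lam σ X o₁ o₂ with hs
  obtain ⟨q, hqdef⟩ : ∃ q, q = (⟨o₁, o₂⟩ : ℂ) / (√w : ℝ) := ⟨_, rfl⟩
  have hq : q ≠ 0 := by rw [hqdef]; exact div_ne_zero hne hrw
  have h₁ : w1 s = q * (√w : ℝ) := by
    rw [hqdef, div_mul_cancel₀ _ hrw]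
    rfl
  have h₂ : w2 s = (√w : ℝ) / q := by
    have h3 := w1_mul_w2 s
    rw [eq_div_iff hq, hqdef, mul_div_assoc', div_eq_iff hrw, ← sq, hw2, hwdef, mul_comm]
    exact h3
  obtain ⟨fx, fx', fy, fy', fz, fz'⟩ :=
    formulas_eq hlam hσ hu (hwdef ▸ hw) hq hX h₁ h₂
  rw [← hqdef]
  refine ⟨hwdef ▸ hw, (quadratic_iff hq (hwdef ▸ hw) h₁ h₂).2 ?_, h₁, h₂, ?_, ?_, ?_, ?_, ?_, ?_, ?_⟩
  · rw [hwdef]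
    exact (Q_mul_eq_iff (r2_pos hb hab).ne' hlam hσ hu hw.ne').2 hT
  · rw [hwdef, w3, hs, om_param_two]
    push_cast
    ring
  · rw [fx]
    rw [show (X : ℂ) - (lam ^ 2 + σ) / σ * w1 s ^ 2 = (X : ℝ) - (((lam ^ 2 + σ) / σ : ℝ) : ℂ)
      * w1 s ^ 2 by push_cast; ring]
    apply Complex.ext <;>
    simp only [x1, w1, sq, Complex.sub_re, Complex.mul_re, Complex.ofReal_re, Complex.sub_im,
      Complex.mul_im, Complex.ofReal_im, hs, al_param_zero, al_param_one, be_param_zero,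
      be_param_one, om_param_zero, om_param_one] <;> ring
  · rw [fx']
    rw [show (X : ℂ) - (lam ^ 2 + σ) / σ * w2 s ^ 2 = (X : ℝ) - (((lam ^ 2 + σ) / σ : ℝ) : ℂ)
      * w2 s ^ 2 by push_cast; ring]
    apply Complex.ext <;>
    simp only [x2, w2, sq, Complex.sub_re, Complex.mul_re, Complex.ofReal_re, Complex.sub_im,
      Complex.mul_im, Complex.ofReal_im, hs, al_param_zero, al_param_one, be_param_zero,
      be_param_one, om_param_zero, om_param_one] <;> ring
  · rw [fy]
    rw [show ((σ : ℂ) * (lam ^ 2 + σ) - X ^ 2) / lam ^ 2 + X / σ * w1 s ^ 2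
      = (((σ * (lam ^ 2 + σ) - X ^ 2) / lam ^ 2 : ℝ) : ℂ) + ((X / σ : ℝ) : ℂ) * w1 s ^ 2 by
        push_cast; ring]
    apply Complex.ext <;>
    simp only [y1, w1, sq, Complex.add_re, Complex.mul_re, Complex.ofReal_re, Complex.add_im,
      Complex.mul_im, Complex.ofReal_im, hs, al_param_zero, al_param_one, be_param_zero,
      be_param_one, om_param_zero, om_param_one] <;> ring
  · rw [fy']
    rw [show ((σ : ℂ) * (lam ^ 2 + σ) - X ^ 2) / lam ^ 2 + X / σ * w2 s ^ 2
      = (((σ * (lam ^ 2 + σ) - X ^ 2) / lam ^ 2 : ℝ) : ℂ) + ((X / σ : ℝ) : ℂ) * w2 s ^ 2 by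
        push_cast; ring]
    apply Complex.ext <;>
    simp only [y2, w2, sq, Complex.add_re, Complex.mul_re, Complex.ofReal_re, Complex.add_im,
      Complex.mul_im, Complex.ofReal_im, hs, al_param_zero, al_param_one, be_param_zero,
      be_param_one, om_param_zero, om_param_one] <;> ring
  · rw [fz]
    rw [show -((X : ℂ) / lam) * w2 s + (lam ^ 2 + σ) / lam * w1 s
      = ((-(X / lam) : ℝ) : ℂ) * w2 s + (((lam ^ 2 + σ) / lam : ℝ) : ℂ) * w1 s by push_cast; ring]
    apply Complex.ext <;>
    simp only [z1, w1, w2, Complex.add_re, Complex.mul_re, Complex.ofReal_re, Complex.add_im,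
      Complex.mul_im, Complex.ofReal_im, hs, al_param_two, be_param_two, om_param_zero,
      om_param_one] <;> ring
  · rw [fz']
    rw [show -((X : ℂ) / lam) * w1 s + (lam ^ 2 + σ) / lam * w2 s
      = ((-(X / lam) : ℝ) : ℂ) * w1 s + (((lam ^ 2 + σ) / lam : ℝ) : ℂ) * w2 s by push_cast; ring]
    apply Complex.ext <;>
    simp only [z2, w1, w2, Complex.add_re, Complex.mul_re, Complex.ofReal_re, Complex.add_im,
      Complex.mul_im, Complex.ofReal_im, hs, al_param_two, be_param_two, om_param_zero,
      om_param_one] <;> ring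

end KowalevskiGyrostat

end

noncomputable section

namespace KowalevskiGyrostat

theorem hasDerivAt_fst_snd {p : ℝ → ℝ × ℝ} {v : ℝ × ℝ} {t : ℝ} (h : HasDerivAt p v t) :
    HasDerivAt (fun t => (p t).1) v.1 t ∧ HasDerivAt (fun t => (p t).2) v.2 t :=
  ⟨by simpa using h.hasFDerivAt.fst.hasDerivAt, by simpa using h.hasFDerivAt.snd.hasDerivAt⟩

/-! ### Derivatives of curves in the space of states -/

theorem hasDerivAt_state_iff {γ : ℝ → State} {v : State} {t : ℝ} :
    HasDerivAt γ v t ↔ ∀ i, HasDerivAt (fun t => om (γ t) i) (om v i) t ∧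
      HasDerivAt (fun t => al (γ t) i) (al v i) t ∧
      HasDerivAt (fun t => be (γ t) i) (be v i) t := by
  constructor
  · intro h i
    exact ⟨hasDerivAt_pi.1 h.fst i, hasDerivAt_pi.1 h.snd.fst i, hasDerivAt_pi.1 h.snd.snd i⟩
  · intro h
    exact (hasDerivAt_pi.2 fun i => (h i).1).prodMk
      ((hasDerivAt_pi.2 fun i => (h i).2.1).prodMk (hasDerivAt_pi.2 fun i => (h i).2.2))

section field

variable (lam : ℝ) (s : State)

theorem om_field_zero : om (field lam s) 0 = (om s 1 * (om s 2 - lam) + be s 2) / 2 := rfl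
theorem om_field_one : om (field lam s) 1 = (-(om s 0) * (om s 2 - lam) - al s 2) / 2 := rfl
theorem om_field_two : om (field lam s) 2 = al s 1 - be s 0 := rfl
theorem al_field_zero : al (field lam s) 0 = al s 1 * om s 2 - al s 2 * om s 1 := rfl
theorem al_field_one : al (field lam s) 1 = al s 2 * om s 0 - al s 0 * om s 2 := rfl
theorem al_field_two : al (field lam s) 2 = al s 0 * om s 1 - al s 1 * om s 0 := rfl
theorem be_field_zero : be (field lam s) 0 = be s 1 * om s 2 - be s 2 * om s 1 := rfl
theorem be_field_one : be (field lam s) 1 = be s 2 * om s 0 - be s 0 * om s 2 := rfl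
theorem be_field_two : be (field lam s) 2 = be s 0 * om s 1 - be s 1 * om s 0 := rfl

end field

theorem contDiff_field (lam : ℝ) : ContDiff ℝ 1 (field lam) := by
  have W : ∀ i, ContDiff ℝ 1 (fun s : State => om s i) := fun i => by unfold om; fun_prop
  have A : ∀ i, ContDiff ℝ 1 (fun s : State => al s i) := fun i => by unfold al; fun_prop
  have B : ∀ i, ContDiff ℝ 1 (fun s : State => be s i) := fun i => by unfold be; fun_prop
  refine ContDiff.prodMk (contDiff_pi.2 fun i => ?_)
    (ContDiff.prodMk (contDiff_pi.2 fun i => ?_) (contDiff_pi.2 fun i => ?_))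
  · fin_cases i
    · exact (((W 1).mul ((W 2).sub contDiff_const)).add (B 2)).div_const 2
    · exact (((W 0).neg.mul ((W 2).sub contDiff_const)).sub (A 2)).div_const 2
    · exact (A 1).sub (B 0)
  · fin_cases i
    · exact ((A 1).mul (W 2)).sub ((A 2).mul (W 1))
    · exact ((A 2).mul (W 0)).sub ((A 0).mul (W 2))
    · exact ((A 0).mul (W 1)).sub ((A 1).mul (W 0))
  · fin_cases i
    · exact ((B 1).mul (W 2)).sub ((B 2).mul (W 1))
    · exact ((B 2).mul (W 0)).sub ((B 0).mul (W 2))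
    · exact ((B 0).mul (W 1)).sub ((B 1).mul (W 0))

/-- A motion that passes through a zero of the vector field is constant. -/
theorem IsMotion.eq_of_field_eq_zero {a b lam : ℝ} {γ : ℝ → State} (h : IsMotion a b lam γ)
    {t₀ : ℝ} (h0 : field lam (γ t₀) = 0) (t : ℝ) : γ t = γ t₀ :=
  congrFun (eq_of_hasDerivAt_of_contDiff (contDiff_field lam) (δ := fun _ => γ t₀) h.2
    (fun t => by rw [h0]; exact hasDerivAt_const t _) (t₀ := t₀) rfl) t

theorem IsMotion.nonconstant {a b lam : ℝ} {γ : ℝ → State} (h : IsMotion a b lam γ)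
    {t₀ : ℝ} (h0 : field lam (γ t₀) ≠ 0) : Nonconstant γ := by
  by_contra hcon
  have hc : γ = fun _ => γ t₀ := by
    funext t
    by_contra hne
    exact hcon ⟨t, t₀, hne⟩
  have h1 : HasDerivAt γ 0 t₀ := by
    rw [hc]
    exact hasDerivAt_const t₀ _
  exact h0 ((h.2 t₀).unique h1)

theorem isClosed_phaseSpace (a b : ℝ) : IsClosed (phaseSpace a b) :=
  isClosed_singleton.preimage (f := geom) differentiable_geom.continuous

/-! ### The reduced planar system -/

/-- The restriction of the vector field to the parametrized family. -/
def planarField (lam σ X : ℝ) (p : ℝ × ℝ) : ℝ × ℝ :=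
  (p.2 / 2 * (lam / σ * (p.1 ^ 2 + p.2 ^ 2) + σ / lam + X / lam),
   -(p.1 / 2) * (lam / σ * (p.1 ^ 2 + p.2 ^ 2) + σ / lam - X / lam))

theorem contDiff_planarField (lam σ X : ℝ) : ContDiff ℝ 1 (planarField lam σ X) := by
  unfold planarField
  fun_prop

theorem om_field_param {lam σ X o₁ o₂ : ℝ} (hlam : lam ≠ 0) (hσ : σ ≠ 0) :
    (om (field lam (param lam σ X o₁ o₂)) 0, om (field lam (param lam σ X o₁ o₂)) 1)
      = planarField lam σ X (o₁, o₂) := by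
  rw [om_field_zero, om_field_one, planarField, om_param_zero, om_param_one, om_param_two,
    al_param_two, be_param_two, Prod.mk.injEq]
  constructor <;> field_simp <;> ring

/-- Integral curves of the planar system give integral curves of the full system. -/
theorem hasDerivAt_param {lam σ X : ℝ} (hlam : lam ≠ 0) (hσ : σ ≠ 0) {p : ℝ → ℝ × ℝ} {t : ℝ}
    (hp : HasDerivAt p (planarField lam σ X (p t)) t) :
    HasDerivAt (fun t => param lam σ X (p t).1 (p t).2)
      (field lam (param lam σ X (p t).1 (p t).2)) t := by
  obtain ⟨hx, hy⟩ := hasDerivAt_fst_snd hp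
  simp only [planarField] at hx hy
  have hw := (hx.pow 2).add (hy.pow 2)
  have hD := (hx.pow 2).sub (hy.pow 2)
  have hxy := hx.mul hy
  rw [hasDerivAt_state_iff]
  refine Fin.forall_fin_succ.2 ⟨⟨?_, ?_, ?_⟩, Fin.forall_fin_succ.2 ⟨⟨?_, ?_, ?_⟩,
    Fin.forall_fin_one.2 ⟨?_, ?_, ?_⟩⟩⟩
  · change HasDerivAt (fun t => (p t).1) _ t
    refine hx.congr_deriv ?_
    change _ = om (field lam _) 0
    rw [om_field_zero, om_param_one, om_param_two, be_param_two]
    field_simp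
    ring
  · change HasDerivAt (fun t => (X + (σ * (lam ^ 2 + σ) - X ^ 2) / lam ^ 2
        + (X - (lam ^ 2 + σ)) * ((p t).1 ^ 2 - (p t).2 ^ 2) / σ) / 2) _ t
    refine ((((hD.const_mul (X - (lam ^ 2 + σ))).div_const σ).const_add _).div_const 2).congr_deriv ?_
    change _ = al (field lam _) 0
    rw [al_field_zero, om_param_one, om_param_two, al_param_one, al_param_two]
    field_simp
    ring
  · change HasDerivAt (fun t => -(X + (lam ^ 2 + σ)) * ((p t).1 * (p t).2) / σ) _ t
    refine ((hxy.const_mul (-(X + (lam ^ 2 + σ)))).div_const σ).congr_deriv ?_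
    change _ = be (field lam _) 0
    rw [be_field_zero, om_param_one, om_param_two, be_param_one, be_param_two]
    field_simp
    ring
  · change HasDerivAt (fun t => (p t).2) _ t
    refine hy.congr_deriv ?_
    change _ = om (field lam _) 1
    rw [om_field_one, om_param_zero, om_param_two, al_param_two]
    field_simp
    ring
  · change HasDerivAt (fun t => (X - (lam ^ 2 + σ)) * ((p t).1 * (p t).2) / σ) _ t
    refine ((hxy.const_mul (X - (lam ^ 2 + σ))).div_const σ).congr_deriv ?_
    change _ = al (field lam _) 1
    rw [al_field_one, om_param_zero, om_param_two, al_param_zero, al_param_two]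
    field_simp
    ring
  · change HasDerivAt (fun t => ((σ * (lam ^ 2 + σ) - X ^ 2) / lam ^ 2 - X
        + (X + (lam ^ 2 + σ)) * ((p t).1 ^ 2 - (p t).2 ^ 2) / σ) / 2) _ t
    refine ((((hD.const_mul (X + (lam ^ 2 + σ))).div_const σ).const_add _).div_const 2).congr_deriv ?_
    change _ = be (field lam _) 1
    rw [be_field_one, om_param_zero, om_param_two, be_param_zero, be_param_two]
    field_simp
    ring
  · change HasDerivAt (fun t => lam / σ * ((p t).1 ^ 2 + (p t).2 ^ 2)) _ t
    refine (hw.const_mul (lam / σ)).congr_deriv ?_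
    change _ = om (field lam _) 2
    rw [om_field_two, al_param_one, be_param_zero]
    field_simp
    ring
  · change HasDerivAt (fun t => ((lam ^ 2 + σ) - X) * (p t).1 / lam) _ t
    refine ((hx.const_mul ((lam ^ 2 + σ) - X)).div_const lam).congr_deriv ?_
    change _ = al (field lam _) 2
    rw [al_field_two, om_param_zero, om_param_one, al_param_zero, al_param_one]
    field_simp
    ring
  · change HasDerivAt (fun t => ((lam ^ 2 + σ) + X) * (p t).2 / lam) _ t
    refine ((hy.const_mul ((lam ^ 2 + σ) + X)).div_const lam).congr_deriv ?_
    change _ = be (field lam _) 2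
    rw [be_field_two, om_param_zero, om_param_one, be_param_zero, be_param_one]
    field_simp
    ring

/-- The planar Hamiltonian is a first integral. -/
theorem hasDerivAt_planarH {lam σ X : ℝ} (hlam : lam ≠ 0) (hσ : σ ≠ 0) {p : ℝ → ℝ × ℝ} {t c : ℝ}
    (hp : HasDerivAt p (c • planarField lam σ X (p t)) t) :
    HasDerivAt (fun t => planarH lam σ X (p t).1 (p t).2) 0 t := by
  obtain ⟨hx, hy⟩ := hasDerivAt_fst_snd hp
  simp only [planarField, Prod.smul_mk, smul_eq_mul] at hx hy
  have hw := (hx.pow 2).add (hy.pow 2)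
  have hD := (hx.pow 2).sub (hy.pow 2)
  -- The planar field is λσ/8 times the symplectic gradient of `planarH`, so the derivative of
  -- `planarH` along it vanishes whatever the factor c.
  refine ((((hw.pow 2).div_const (σ ^ 2)).add ((hw.const_mul 2).div_const (lam ^ 2))).sub
    (((hD.const_mul 2).mul_const X).div_const (σ * lam ^ 2))).congr_deriv ?_
  simp only [Pi.add_apply, Pi.pow_apply]
  field_simp
  ring

/-- The levels of the planar Hamiltonian are bounded. -/
theorem exists_bound_planarH {lam σ : ℝ} (hlam : lam ≠ 0) (hσ : σ ≠ 0) (X T : ℝ) :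
    ∃ M, ∀ o₁ o₂, planarH lam σ X o₁ o₂ = T → o₁ ^ 2 + o₂ ^ 2 ≤ M := by
  -- The quartic term dominates: on the level, w > 1 gives w² ≤ Cw with C = σ² (|T| + 2|k|). The
  -- summand 1 covers w ≤ 1.
  refine ⟨1 + σ ^ 2 * (|T| + 2 * |X / (σ * lam ^ 2)|), fun o₁ o₂ h => ?_⟩
  unfold planarH at h
  obtain ⟨k, hk⟩ : ∃ k, k = X / (σ * lam ^ 2) := ⟨_, rfl⟩
  obtain ⟨w, hw⟩ : ∃ w, w = o₁ ^ 2 + o₂ ^ 2 := ⟨_, rfl⟩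
  rw [← hk, ← hw]
  have hw0 : 0 ≤ w := by rw [hw]; positivity
  have h1 : w ^ 2 = σ ^ 2 * (T - 2 * w / lam ^ 2 + 2 * (o₁ ^ 2 - o₂ ^ 2) * k) := by
    rw [← h, hk, hw]
    field_simp
    ring
  have h2 : (o₁ ^ 2 - o₂ ^ 2) * k ≤ w * |k| := by
    refine (le_abs_self _).trans ?_
    rw [abs_mul]
    refine mul_le_mul_of_nonneg_right (abs_le.2 ⟨?_, ?_⟩) (abs_nonneg k) <;>
      nlinarith [sq_nonneg o₁, sq_nonneg o₂]
  have h3 : 0 ≤ 2 * w / lam ^ 2 := by positivity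
  have h4 : w ^ 2 ≤ σ ^ 2 * (|T| + 2 * (w * |k|)) := by
    rw [h1]
    refine mul_le_mul_of_nonneg_left ?_ (sq_nonneg σ)
    linarith [le_abs_self T]
  by_contra! hcon
  have hpos : 0 ≤ σ ^ 2 * (|T| + 2 * |k|) := by positivity
  have hw1 : 1 < w := by linarith
  have h5 : σ ^ 2 * (|T| + 2 * (w * |k|)) ≤ σ ^ 2 * (|T| + 2 * |k|) * w := by
    have : |T| ≤ |T| * w := le_mul_of_one_le_right (abs_nonneg T) hw1.le
    have := mul_le_mul_of_nonneg_left this (sq_nonneg σ)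
    linarith
  nlinarith

/-- The planar system has global solutions; they stay on the level of the Hamiltonian and, unless
they are zero, do not vanish. -/
theorem exists_planar_solution {lam σ : ℝ} (hlam : lam ≠ 0) (hσ : σ ≠ 0) (X o₁ o₂ : ℝ)
    (h0 : o₁ ^ 2 + o₂ ^ 2 ≠ 0) : ∃ p : ℝ → ℝ × ℝ, p 0 = (o₁, o₂) ∧
      (∀ t, HasDerivAt p (planarField lam σ X (p t)) t) ∧
      (∀ t, planarH lam σ X (p t).1 (p t).2 = planarH lam σ X o₁ o₂) ∧
      ∀ t, 0 < (p t).1 ^ 2 + (p t).2 ^ 2 := by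
  obtain ⟨M, hM⟩ := exists_bound_planarH hlam hσ X (planarH lam σ X o₁ o₂)
  have hb : Bornology.IsBounded {p : ℝ × ℝ | planarH lam σ X p.1 p.2 = planarH lam σ X o₁ o₂} := by
    refine (Metric.isBounded_closedBall (x := (0 : ℝ × ℝ)) (r := M + 1)).subset fun p hp => ?_
    have h1 := hM p.1 p.2 hp
    rw [mem_closedBall_zero_iff, Prod.norm_def, max_le_iff, Real.norm_eq_abs, Real.norm_eq_abs,
      abs_le, abs_le]
    refine ⟨⟨?_, ?_⟩, ?_, ?_⟩ <;>
      nlinarith [sq_nonneg p.1, sq_nonneg p.2, sq_nonneg (p.1 - 1), sq_nonneg (p.1 + 1),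
        sq_nonneg (p.2 - 1), sq_nonneg (p.2 + 1)]
  obtain ⟨p, hp0, hp, hV⟩ := exists_forall_hasDerivAt_of_first_integral
    (contDiff_planarField lam σ X) (V := fun p => planarH lam σ X p.1 p.2)
    (fun γ t c h => hasDerivAt_planarH hlam hσ h) (o₁, o₂) hb
  refine ⟨p, hp0, hp, hV, fun t => ?_⟩
  -- The origin is a rest point of the planar system, so by uniqueness a solution starting elsewhere
  -- never reaches it.
  by_contra! hcon
  have e1 : (p t).1 = 0 := by nlinarith [sq_nonneg (p t).1, sq_nonneg (p t).2]
  have e2 : (p t).2 = 0 := by nlinarith [sq_nonneg (p t).1, sq_nonneg (p t).2]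
  have e : p = fun _ => (0, 0) :=
    eq_of_hasDerivAt_of_contDiff (contDiff_planarField lam σ X) hp
      (fun t => by simpa [planarField] using! hasDerivAt_const t (0 : ℝ × ℝ)) (t₀ := t)
      (Prod.ext e1 e2)
  rw [e, Prod.mk.injEq] at hp0
  apply h0
  rw [← hp0.1, ← hp0.2]
  norm_num

/-- The evolution of `w` in terms of the polynomials `P₊`, `P₋`. -/
theorem sq_deriv_eq {a b lam σ u o₁ o₂ : ℝ} (hlam : lam ≠ 0) (hσ : σ ≠ 0)
    (hu : u ≠ 0)
    (hT : planarH lam σ (r2 a b * lam ^ 2 * σ / u) o₁ o₂ = -(Pconst a b lam σ u) / σ ^ 2) :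
    (2 * (r2 a b * lam ^ 2 * σ / u) / lam * (o₁ * o₂)) ^ 2 = -(lam ^ 2 / (4 * σ ^ 2))
      * Pplus a b lam σ u (o₁ ^ 2 + o₂ ^ 2) * Pminus a b lam σ u (o₁ ^ 2 + o₂ ^ 2) := by
  -- Reason for the factorization: with w = o₁² + o₂², D = o₁² - o₂² and X = r²λ²σ/u one has D + w =
  -- λ²P₊/(2Xσ) and D - w = λ²P₋/(2Xσ), while 4o₁²o₂² = w² - D².
  have hP : Pconst a b lam σ u
      = -σ ^ 2 * planarH lam σ (r2 a b * lam ^ 2 * σ / u) o₁ o₂ := by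
    rw [hT]
    field_simp
  rw [Pplus, Pminus, hP, planarH]
  field_simp
  ring

theorem hasDerivAt_sq_add_sq {lam σ X : ℝ} {p : ℝ → ℝ × ℝ} {t : ℝ}
    (hp : HasDerivAt p (planarField lam σ X (p t)) t) :
    HasDerivAt (fun t => (p t).1 ^ 2 + (p t).2 ^ 2) (2 * X / lam * ((p t).1 * (p t).2)) t := by
  obtain ⟨hx, hy⟩ := hasDerivAt_fst_snd hp
  simp only [planarField] at hx hy
  refine ((hx.pow 2).add (hy.pow 2)).congr_deriv ?_
  simp
  ring

/-- Through every point given by the explicit formulas passes a motion of the second family. -/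
theorem exists_isSecondMotion {a b lam σ u w : ℝ} {q : ℂ} {s : State} (hb : 0 < b)
    (hab : b < a) (hlam : lam ≠ 0) (hσ : σ ≠ 0) (hQ : Quintic a b lam σ u)
    (h : SecondFormulas a b lam σ u w q s) : ∃ γ, IsSecondMotion a b lam σ u γ ∧ γ 0 = s := by
  have hu := hQ.ne_zero hb hab hlam hσ
  obtain ⟨hw, hs, hT⟩ := h.eq_param hb hab hlam hσ hQ
  obtain ⟨p, hp0, hp, hV, hpos⟩ := exists_planar_solution hlam hσ (r2 a b * lam ^ 2 * σ / u)
    (om s 0) (om s 1) (hw ▸ h.1.ne')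
  rw [hT] at hV
  refine ⟨fun t => param lam σ (r2 a b * lam ^ 2 * σ / u) (p t).1 (p t).2,
    ⟨⟨fun t => ?_, fun t => hasDerivAt_param hlam hσ (hp t)⟩, hσ, hQ, _, _, _, fun t =>
      ⟨secondFormulas_param hb hab hlam hσ hu (hpos t) (hV t), hasDerivAt_sq_add_sq (hp t),
        sq_deriv_eq hlam hσ hu (hV t)⟩⟩, ?_⟩
  · rw [param_mem_phaseSpace_iff hlam hσ, hV]
    exact hQ.compatible hb hab hlam hσ
  · simp only [hp0]
    exact hs.symm

end KowalevskiGyrostat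

end

noncomputable section

namespace KowalevskiGyrostat

/-! ### Periodicity of the motions of the second family -/

/-- The value of `o₁ ^ 2 - o₂ ^ 2` in terms of `o₁ ^ 2 + o₂ ^ 2` on the level `T` of the planar
Hamiltonian. -/
def levelDiff (lam σ X T y : ℝ) : ℝ :=
  (y ^ 2 / σ ^ 2 + 2 * y / lam ^ 2 - T) * (σ * lam ^ 2) / (2 * X)

theorem levelDiff_eq {lam σ X o₁ o₂ : ℝ} (hlam : lam ≠ 0) (hσ : σ ≠ 0) (hX : X ≠ 0) :
    levelDiff lam σ X (planarH lam σ X o₁ o₂) (o₁ ^ 2 + o₂ ^ 2) = o₁ ^ 2 - o₂ ^ 2 := by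
  unfold levelDiff planarH
  field_simp
  ring

/-- The force in the equation `w'' = F(w)`. -/
def levelForce (lam σ X T y : ℝ) : ℝ :=
  X / lam * (X / lam * y - levelDiff lam σ X T y * (lam / σ * y + σ / lam))

/-- The right-hand side of the equation `w' ^ 2 = f(w)`. -/
def levelEnergy (lam σ X T y : ℝ) : ℝ :=
  X ^ 2 / lam ^ 2 * (y ^ 2 - levelDiff lam σ X T y ^ 2)

/-- The motion cannot tend to an equilibrium with `w ≠ 0`. -/
theorem double_zero_nonpos {a b lam σ X T x : ℝ} (hb : 0 < b) (hab : b < a) (hlam : lam ≠ 0)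
    (hσ : σ ≠ 0) (hC : Compatible a b lam σ X T) (hf : levelEnergy lam σ X T x = 0)
    (hF : levelForce lam σ X T x = 0) : x ≤ 0 := by
  have hX := hC.ne_zero hb hab
  by_contra! hx
  obtain ⟨D, hD⟩ : ∃ D, D = levelDiff lam σ X T x := ⟨_, rfl⟩
  have hT : T = x ^ 2 / σ ^ 2 + 2 * x / lam ^ 2 - 2 * D * X / (σ * lam ^ 2) := by
    rw [hD, levelDiff]
    field_simp
    ring
  rw [levelEnergy, ← hD] at hf
  rw [levelForce, ← hD] at hF
  have hf' := (mul_eq_zero.1 hf).resolve_left (by positivity)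
  have hF' := (mul_eq_zero.1 hF).resolve_left (by positivity)
  -- A common zero x > 0 corresponds to a rest point of the planar system on a coordinate axis: D =
  -- x is the axis o₂ = 0 and D = -x the axis o₁ = 0. Then F = 0 fixes X, and compatibility
  -- collapses to b = 0 or a = 0 respectively.
  have hcases : (D - x) * (D + x) = 0 := by linear_combination -hf'
  obtain ⟨h1, h2⟩ := hC
  rcases mul_eq_zero.1 hcases with h | h
  · obtain rfl : D = x := by linarith
    have hXe : X = lam ^ 2 * D / σ + σ := by
      have h3 : D * (X / lam - (lam / σ * D + σ / lam)) = 0 := by linear_combination hF'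
      have h4 := (mul_eq_zero.1 h3).resolve_left hx.ne'
      have h5 : X = lam * (X / lam) := by field_simp
      rw [h5, sub_eq_zero.1 h4]
      field_simp
    have h6 : 4 * b ^ 2 = 0 := by
      rw [h2, hT, hXe]
      field_simp
      ring
    nlinarith
  · obtain rfl : D = -x := by linarith
    have hXe : X = -(lam ^ 2 * x / σ + σ) := by
      have h3 : x * (X / lam + (lam / σ * x + σ / lam)) = 0 := by linear_combination hF'
      have h4 := (mul_eq_zero.1 h3).resolve_left hx.ne'
      have h5 : X = lam * (X / lam) := by field_simp
      rw [h5, eq_neg_of_add_eq_zero_left h4]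
      field_simp
    have h6 : 4 * a ^ 2 = 0 := by
      rw [h1, hT, hXe]
      field_simp
      ring
    nlinarith

/-- The hypotheses say that x + iy and z + iw have equal squares. This is how a planar point is
recovered up to sign from w and w'. -/
theorem eq_or_eq_neg_of_sq {x y z w : ℝ} (h1 : x ^ 2 - y ^ 2 = z ^ 2 - w ^ 2)
    (h2 : x * y = z * w) : (x, y) = (z, w) ∨ (x, y) = (-z, -w) := by
  have h : (⟨x, y⟩ : ℂ) * ⟨x, y⟩ = ⟨z, w⟩ * ⟨z, w⟩ := by
    apply Complex.ext <;> simp only [Complex.mul_re, Complex.mul_im] <;> linarith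
  rcases mul_self_eq_mul_self_iff.1 h with h | h
  · left
    rw [Complex.ext_iff] at h
    exact Prod.ext h.1 h.2
  · right
    rw [Complex.ext_iff] at h
    exact Prod.ext h.1 h.2

theorem continuous_param (lam σ X : ℝ) : Continuous fun p : ℝ × ℝ => param lam σ X p.1 p.2 := by
  refine Continuous.prodMk (continuous_pi fun i => ?_)
    (Continuous.prodMk (continuous_pi fun i => ?_) (continuous_pi fun i => ?_)) <;>
  fin_cases i <;> simp <;> fun_prop

open Filter in
/-- The motions of the second family are periodic or homoclinic. -/
theorem IsSecondMotion.periodic_or_separatrix {a b lam σ u : ℝ} {γ : ℝ → State} (hb : 0 < b)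
    (hab : b < a) (hlam : lam ≠ 0) (h : IsSecondMotion a b lam σ u γ) :
    IsPeriodicMotion γ ∨ IsSeparatrix a b lam γ := by
  obtain ⟨hm, hσ, hQ, w, q, w', hw'⟩ := h
  obtain ⟨X, hX⟩ : ∃ X, X = r2 a b * lam ^ 2 * σ / u := ⟨_, rfl⟩
  obtain ⟨T, hT⟩ : ∃ T, T = -(Pconst a b lam σ u) / σ ^ 2 := ⟨_, rfl⟩
  have hC := hQ.compatible hb hab hlam hσ
  rw [← hX, ← hT] at hC
  have hX0 := hC.ne_zero hb hab
  have key : ∀ t, 0 < om (γ t) 0 ^ 2 + om (γ t) 1 ^ 2 ∧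
      γ t = param lam σ X (om (γ t) 0) (om (γ t) 1) ∧
      planarH lam σ X (om (γ t) 0) (om (γ t) 1) = T := fun t => by
    have h1 := (hw' t).1.eq_param hb hab hlam hσ hQ
    rw [hX, hT]
    exact ⟨h1.1 ▸ (hw' t).1.1, h1.2⟩
  obtain ⟨p, hpdef⟩ : ∃ p : ℝ → ℝ × ℝ, p = fun t => (om (γ t) 0, om (γ t) 1) := ⟨_, rfl⟩
  have hpos : ∀ t, 0 < (p t).1 ^ 2 + (p t).2 ^ 2 := fun t => by rw [hpdef]; exact (key t).1
  have hγ : ∀ t, γ t = param lam σ X (p t).1 (p t).2 := fun t => by rw [hpdef]; exact (key t).2.1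
  have hH : ∀ t, planarH lam σ X (p t).1 (p t).2 = T := fun t => by rw [hpdef]; exact (key t).2.2
  have hp : ∀ t, HasDerivAt p (planarField lam σ X (p t)) t := fun t => by
    have h1 := hasDerivAt_state_iff.1 (hm.2 t)
    have h2 := (h1 0).1.prodMk (h1 1).1
    rw [hγ t, om_field_param hlam hσ] at h2
    rw [hpdef] at h2 ⊢
    exact h2
  have hnc : Nonconstant γ := hm.nonconstant (t₀ := 0) fun h0 => by
    have h1 := ((field_eq_zero_iff hb hab lam (hm.1 0)).1 h0).1
    have h2 := (key 0).1
    rw [h1.1, h1.2.1] at h2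
    norm_num at h2
  have hdiff : ∀ t, levelDiff lam σ X T ((p t).1 ^ 2 + (p t).2 ^ 2) = (p t).1 ^ 2 - (p t).2 ^ 2 :=
    fun t => by rw [← hH t]; exact levelDiff_eq hlam hσ hX0
  have hy := fun t => hasDerivAt_sq_add_sq (hp t)
  have hv : ∀ t, HasDerivAt (fun t => 2 * X / lam * ((p t).1 * (p t).2))
      (levelForce lam σ X T ((p t).1 ^ 2 + (p t).2 ^ 2)) t := fun t => by
    obtain ⟨h1, h2⟩ := hasDerivAt_fst_snd (hp t)
    refine ((h1.mul h2).const_mul (2 * X / lam)).congr_deriv ?_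
    rw [levelForce, hdiff, planarField]
    ring
  have hE : ∀ t, (2 * X / lam * ((p t).1 * (p t).2)) ^ 2
      = levelEnergy lam σ X T ((p t).1 ^ 2 + (p t).2 ^ 2) := fun t => by
    rw [levelEnergy, hdiff]
    ring
  have hcd : ContDiff ℝ 1 (levelDiff lam σ X T) := by unfold levelDiff; fun_prop
  have hcF : ContDiff ℝ 1 (levelForce lam σ X T) := by unfold levelForce; fun_prop
  have hcf : Continuous (levelEnergy lam σ X T) := by
    have := hcd.continuous
    unfold levelEnergy; fun_prop
  obtain ⟨M, hM⟩ := exists_bound_planarH hlam hσ X T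
  have hcl : ∀ x ∈ closure (Set.range fun t => (p t).1 ^ 2 + (p t).2 ^ 2), 0 ≤ x := fun x hx =>
    closure_minimal (t := Set.Ici (0 : ℝ)) (by rintro _ ⟨t, rfl⟩; exact (hpos t).le)
      isClosed_Ici hx
  have hz : ∀ x ∈ closure (Set.range fun t => (p t).1 ^ 2 + (p t).2 ^ 2),
      levelEnergy lam σ X T x = 0 → levelForce lam σ X T x = 0 → x = 0 := fun x hx h1 h2 =>
    le_antisymm (double_zero_nonpos hb hab hlam hσ hC h1 h2) (hcl x hx)
  rcases newton_dichotomy hcF hcf hy hv hE (M := M)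
    (fun t => by rw [abs_of_pos (hpos t)]; exact hM _ _ (hH t))
    (fun x hx x' hx' h1 h2 h3 h4 => (hz x hx h1 h2).trans (hz x' hx' h3 h4).symm) with
    ⟨S, hS, hper⟩ | ⟨x, hx, h1, h2, htop, hbot⟩
  · left
    -- The quantities w and w' have period S, but they fix p only up to sign. The planar field is
    -- odd, so p (t + S) = ± p t with one sign for all t, and 2S is a period in either case.
    refine ⟨hnc, 2 * S, by linarith, ?_⟩
    have hsign : p (0 + S) = p 0 ∨ p (0 + S) = -p 0 := by
      obtain ⟨e1, e2⟩ := hper 0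
      refine eq_or_eq_neg_of_sq ?_ ?_
      · rw [← hdiff, ← hdiff]
        exact congrArg _ e1
      · exact mul_left_cancel₀ (by positivity) e2
    have hshift : ∀ t, HasDerivAt (fun t => p (t + S)) (planarField lam σ X (p (t + S))) t :=
      fun t => (hp (t + S)).comp_add_const t S
    have hsol : (∀ t, p (t + S) = p t) ∨ ∀ t, p (t + S) = -p t := by
      rcases hsign with h0 | h0
      · left
        exact fun t => congrFun (eq_of_hasDerivAt_of_contDiff (contDiff_planarField lam σ X)
          hshift hp (t₀ := 0) h0) t
      · right
        refine fun t => congrFun (eq_of_hasDerivAt_of_contDiff (contDiff_planarField lam σ X)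
          hshift (δ := fun t => -p t) (fun t => (hp t).neg.congr_deriv ?_) (t₀ := 0) h0) t
        simp only [planarField, Prod.neg_mk, Prod.fst_neg, Prod.snd_neg, Prod.mk.injEq]
        constructor <;> ring
    intro t
    have h2 : p (t + 2 * S) = p t := by
      rw [show t + 2 * S = t + S + S by ring]
      rcases hsol with h0 | h0
      · rw [h0, h0]
      · rw [h0, h0, neg_neg]
    rw [hγ, hγ, h2]
  · right
    obtain rfl := hz x hx h1 h2
    have hlim : ∀ {l : Filter ℝ}, Tendsto (fun t => (p t).1 ^ 2 + (p t).2 ^ 2) l (𝓝 0) →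
        Tendsto γ l (𝓝 (param lam σ X 0 0)) := by
      intro l hl
      have hsqrt : ∀ g : ℝ → ℝ, (∀ t, g t ^ 2 ≤ (p t).1 ^ 2 + (p t).2 ^ 2) →
          Tendsto g l (𝓝 0) := by
        intro g hg
        have h3 : Tendsto (fun t => g t ^ 2) l (𝓝 0) :=
          squeeze_zero (fun t => sq_nonneg _) hg hl
        have h4 := (Real.continuous_sqrt.tendsto 0).comp h3
        simp only [Function.comp_def, Real.sqrt_sq_eq_abs, Real.sqrt_zero] at h4
        exact (tendsto_zero_iff_abs_tendsto_zero g).2 h4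
      have hpl : Tendsto p l (𝓝 ((0 : ℝ), (0 : ℝ))) :=
        (hsqrt (fun t => (p t).1) fun t => by nlinarith [sq_nonneg (p t).2]).prodMk_nhds
          (hsqrt (fun t => (p t).2) fun t => by nlinarith [sq_nonneg (p t).1])
      have := ((continuous_param lam σ X).tendsto ((0 : ℝ), (0 : ℝ))).comp hpl
      refine this.congr fun t => (hγ t).symm
    have hmem : param lam σ X 0 0 ∈ phaseSpace a b :=
      (isClosed_phaseSpace a b).mem_of_tendsto (hlim htop) (Eventually.of_forall hm.1)
    refine ⟨hnc, param lam σ X 0 0, ⟨hmem, ?_⟩, hlim htop, hlim hbot⟩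
    rw [field_eq_zero_iff hb hab lam hmem]
    simp [om_param_zero, om_param_one, om_param_two, al_param_one, al_param_two, be_param_zero,
      be_param_two]

end KowalevskiGyrostat

end

noncomputable section

namespace KowalevskiGyrostat

/-! ### Pendulum motions -/

/-- The state of the pendulum with `cos φ = c`, `sin φ = d` and angular velocity `v`. -/
def pendulumState (a b e : ℝ) (p : ℝ × ℝ × ℝ) : State :=
  (![0, 0, p.2.2], ![a * p.1, -(a * p.2.1), 0], ![e * b * p.2.1, e * b * p.1, 0])

theorem continuous_pendulumState (a b e : ℝ) : Continuous (pendulumState a b e) := by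
  refine Continuous.prodMk (continuous_pi fun i => ?_)
    (Continuous.prodMk (continuous_pi fun i => ?_) (continuous_pi fun i => ?_)) <;>
  fin_cases i <;> simp <;> fun_prop

section

variable {a b e : ℝ} {φ φ' : ℝ → ℝ} {γ : ℝ → State}

theorem isMotion_of_pendulum (lam : ℝ) (he : e = 1 ∨ e = -1)
    (hφ : ∀ t, HasDerivAt φ (φ' t) t)
    (hφ' : ∀ t, HasDerivAt φ' (-(a + e * b) * Real.sin (φ t)) t)
    (hγ : ∀ t, γ t = pendulumState a b e (Real.cos (φ t), Real.sin (φ t), φ' t)) :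
    IsMotion a b lam γ := by
  have he2 : e ^ 2 = 1 := by rcases he with rfl | rfl <;> norm_num
  refine ⟨fun t => ?_, fun t => ?_⟩
  · rw [hγ, mem_phaseSpace_iff]
    have h1 := Real.sin_sq_add_cos_sq (φ t)
    simp only [pendulumState, al, be, Matrix.cons_val_zero, Matrix.cons_val_one, Matrix.cons_val]
    refine ⟨?_, ?_, ?_⟩
    · linear_combination a ^ 2 * h1
    · linear_combination e ^ 2 * b ^ 2 * h1 + b ^ 2 * he2
    · ring
  · have hc := (hφ t).cos
    have hs := (hφ t).sin
    have h0 : HasDerivAt (fun _ : ℝ => (0 : ℝ)) 0 t := hasDerivAt_const t 0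
    rw [funext hγ, hasDerivAt_state_iff]
    refine Fin.forall_fin_succ.2 ⟨⟨?_, ?_, ?_⟩, Fin.forall_fin_succ.2 ⟨⟨?_, ?_, ?_⟩,
      Fin.forall_fin_one.2 ⟨?_, ?_, ?_⟩⟩⟩
    · refine h0.congr_deriv ?_
      change _ = om (field lam _) 0
      rw [om_field_zero]
      simp [pendulumState, om, be]
    · refine (hc.const_mul a).congr_deriv ?_
      change _ = al (field lam _) 0
      rw [al_field_zero]
      simp [pendulumState, om, al]
      ring
    · refine (hs.const_mul (e * b)).congr_deriv ?_
      change _ = be (field lam _) 0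
      rw [be_field_zero]
      simp [pendulumState, om, be]
      ring
    · refine h0.congr_deriv ?_
      change _ = om (field lam _) 1
      rw [om_field_one]
      simp [pendulumState, om, al]
    · refine (hs.const_mul a).neg.congr_deriv ?_
      change _ = al (field lam _) 1
      rw [al_field_one]
      simp [pendulumState, om, al]
      ring
    · refine (hc.const_mul (e * b)).congr_deriv ?_
      change _ = be (field lam _) 1
      rw [be_field_one]
      simp [pendulumState, om, be]
      ring
    · refine (hφ' t).congr_deriv ?_
      change _ = om (field lam _) 2
      rw [om_field_two]
      simp [pendulumState, al, be]
      ring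
    · refine h0.congr_deriv ?_
      change _ = al (field lam _) 2
      rw [al_field_two]
      simp [pendulumState, om]
    · refine h0.congr_deriv ?_
      change _ = be (field lam _) 2
      rw [be_field_two]
      simp [pendulumState, om]

end

theorem IsPendulumMotion.isMotion {a b : ℝ} {γ : ℝ → State} (h : IsPendulumMotion a b γ)
    (lam : ℝ) : IsMotion a b lam γ := by
  obtain ⟨e, φ, φ', he, h⟩ := h
  exact isMotion_of_pendulum lam he (fun t => (h t).1) (fun t => (h t).2.1) fun t => (h t).2.2

theorem IsPendulumMotion.isPlanar {a b : ℝ} {γ : ℝ → State} (h : IsPendulumMotion a b γ) (t : ℝ) :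
    IsPlanar (γ t) := by
  obtain ⟨e, φ, φ', he, h⟩ := h
  rw [(h t).2.2]
  exact ⟨rfl, rfl, rfl, rfl⟩

/-- The equation of the pendulum has global solutions. -/
theorem exists_pendulum_solution (k φ₀ v₀ : ℝ) : ∃ φ φ' : ℝ → ℝ, φ 0 = φ₀ ∧ φ' 0 = v₀ ∧
    (∀ t, HasDerivAt φ (φ' t) t) ∧ ∀ t, HasDerivAt φ' (-k * Real.sin (φ t)) t := by
  have hcd : ContDiff ℝ 1 (fun p : ℝ × ℝ => (p.2, -k * Real.sin p.1)) := by fun_prop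
  have hL : LipschitzWith (1 + ‖k‖₊) (fun p : ℝ × ℝ => (p.2, -k * Real.sin p.1)) := by
    refine LipschitzWith.of_dist_le_mul fun p q => ?_
    have h1 : |Real.sin p.1 - Real.sin q.1| ≤ |p.1 - q.1| := by
      simpa [Real.dist_eq] using Real.lipschitzWith_sin.dist_le_mul p.1 q.1
    simp only [Prod.dist_eq, Real.dist_eq]
    have hm1 := le_max_left |p.1 - q.1| |p.2 - q.2|
    have hm2 := le_max_right |p.1 - q.1| |p.2 - q.2|
    have hm0 := (abs_nonneg _).trans hm1
    have hk := abs_nonneg k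
    push_cast
    rw [Real.norm_eq_abs]
    refine max_le (by nlinarith) ?_
    rw [← mul_sub, abs_mul, abs_neg]
    have := mul_le_mul_of_nonneg_left (h1.trans hm1) hk
    nlinarith
  obtain ⟨γ, h0, hγ⟩ := exists_forall_hasDerivAt_of_lipschitzWith hcd hL (φ₀, v₀)
  exact ⟨fun t => (γ t).1, fun t => (γ t).2, by simp [h0], by simp [h0],
    fun t => (hasDerivAt_fst_snd (hγ t)).1, fun t => (hasDerivAt_fst_snd (hγ t)).2⟩

/-- Through every point with `ω₁ = ω₂ = α₃ = β₃ = 0` passes a pendulum motion. -/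
theorem IsPlanar.exists_pendulumMotion {a b : ℝ} (hb : 0 < b) (hab : b < a) {s : State}
    (hs : s ∈ phaseSpace a b) (h : IsPlanar s) : ∃ γ, IsPendulumMotion a b γ ∧ γ 0 = s := by
  have ha : 0 < a := hb.trans hab
  obtain ⟨e, he, e0, e1⟩ := h.exists_sign hb hab hs
  obtain ⟨g1, -, -⟩ := mem_phaseSpace_iff.1 hs
  obtain ⟨h0, h1, h2, h3⟩ := h
  rw [h2] at g1
  obtain ⟨φ₀, hcos, hsin⟩ : ∃ φ₀, a * Real.cos φ₀ = al s 0 ∧ -(a * Real.sin φ₀) = al s 1 := by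
    obtain ⟨z, hz⟩ : ∃ z : ℂ, z = ⟨al s 0, -al s 1⟩ := ⟨_, rfl⟩
    have hn : ‖z‖ = a := by
      rw [← sq_eq_sq₀ (norm_nonneg _) ha.le, ← g1, Complex.sq_norm, Complex.normSq_apply, hz]
      ring
    refine ⟨z.arg, ?_, ?_⟩
    · rw [← hn, Complex.norm_mul_cos_arg, hz]
    · rw [← hn, Complex.norm_mul_sin_arg, hz]
      simp
  obtain ⟨φ, φ', hφ0, hφ'0, hφ, hφ'⟩ := exists_pendulum_solution (a + e * b) φ₀ (om s 2)
  refine ⟨fun t => pendulumState a b e (Real.cos (φ t), Real.sin (φ t), φ' t),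
    ⟨e, φ, φ', he, fun t => ⟨hφ t, hφ' t, rfl⟩⟩, ?_⟩
  simp only [hφ0, hφ'0]
  refine state_ext h0.symm h1.symm rfl hcos hsin h2.symm ?_ ?_ h3.symm
  · rw [e0, ← hsin]
    change e * b * Real.sin φ₀ = _
    field_simp
  · rw [e1, ← hcos]
    change e * b * Real.cos φ₀ = _
    field_simp

open Filter in
/-- The non-constant pendulum motions are periodic or homoclinic. -/
theorem IsPendulumMotion.periodic_or_separatrix {a b : ℝ} {γ : ℝ → State} (hb : 0 < b)
    (hab : b < a) (lam : ℝ) (h : IsPendulumMotion a b γ) (hnc : Nonconstant γ) :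
    IsPeriodicMotion γ ∨ IsSeparatrix a b lam γ := by
  have hm := h.isMotion lam
  obtain ⟨e, φ, φ', he, h⟩ := h
  obtain ⟨k, hk⟩ : ∃ k, k = a + e * b := ⟨_, rfl⟩
  -- For e = -1 this uses b < a.
  have hk0 : 0 < k := by rcases he with rfl | rfl <;> rw [hk] <;> linarith
  have hφ : ∀ t, HasDerivAt φ (φ' t) t := fun t => (h t).1
  have hφ' : ∀ t, HasDerivAt φ' (-k * Real.sin (φ t)) t := fun t => by rw [hk]; exact (h t).2.1
  have hγ : ∀ t, γ t = pendulumState a b e (Real.cos (φ t), Real.sin (φ t), φ' t) :=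
    fun t => (h t).2.2
  obtain ⟨E, hE⟩ : ∃ E, ∀ t, φ' t ^ 2 = 2 * (E + k * Real.cos (φ t)) := by
    refine ⟨φ' 0 ^ 2 / 2 - k * Real.cos (φ 0), fun t => ?_⟩
    have hd : ∀ t, HasDerivAt (fun t => φ' t ^ 2 / 2 - k * Real.cos (φ t)) 0 t := fun t => by
      refine ((((hφ' t).pow 2).div_const 2).sub ((hφ t).cos.const_mul k)).congr_deriv ?_
      simp
      ring
    have := is_const_of_deriv_eq_zero (fun t => (hd t).differentiableAt)
      (fun t => (hd t).deriv) t 0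
    linarith
  -- At the minimal energy the pendulum rests at φ = 0, which non-constancy excludes.
  have hEk : E ≠ -k := by
    rintro rfl
    obtain ⟨t₁, t₂, hne⟩ := hnc
    have hst : ∀ t, γ t = pendulumState a b e (1, 0, 0) := fun t => by
      have h1 : Real.cos (φ t) = 1 := by
        refine le_antisymm (Real.cos_le_one _) ?_
        have h2 : 0 ≤ k * (Real.cos (φ t) - 1) := by nlinarith [hE t, sq_nonneg (φ' t)]
        linarith [nonneg_of_mul_nonneg_right h2 hk0]
      have h2 : Real.sin (φ t) = 0 := by
        have := Real.sin_sq_add_cos_sq (φ t)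
        rw [h1] at this
        exact pow_eq_zero_iff two_ne_zero |>.1 (by linarith)
      have h3 : φ' t = 0 := by
        have := hE t
        rw [h1] at this
        exact pow_eq_zero_iff two_ne_zero |>.1 (by linarith)
      rw [hγ, h1, h2, h3]
    exact hne ((hst t₁).trans (hst t₂).symm)
  -- The angle itself is unbounded for rotations; cos φ is always bounded and still obeys a Newton
  -- equation. The only common zero left is cos φ = -1 at the separatrix energy E = k.
  have hy : ∀ t, HasDerivAt (fun t => Real.cos (φ t)) (-Real.sin (φ t) * φ' t) t := fun t =>
    (hφ t).cos
  have hv : ∀ t, HasDerivAt (fun t => -Real.sin (φ t) * φ' t)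
      (k * (1 - Real.cos (φ t) ^ 2) - 2 * Real.cos (φ t) * (E + k * Real.cos (φ t))) t :=
    fun t => by
      refine ((hφ t).sin.neg.mul (hφ' t)).congr_deriv ?_
      simp only [Pi.neg_apply]
      linear_combination -Real.cos (φ t) * hE t + k * Real.sin_sq_add_cos_sq (φ t)
  have hen : ∀ t, (-Real.sin (φ t) * φ' t) ^ 2
      = (1 - Real.cos (φ t) ^ 2) * (2 * (E + k * Real.cos (φ t))) := fun t => by
    rw [← hE t, ← Real.sin_sq]
    ring
  have hz : ∀ x, (1 - x ^ 2) * (2 * (E + k * x)) = 0 →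
      k * (1 - x ^ 2) - 2 * x * (E + k * x) = 0 → x = -1 ∧ E = k := by
    intro x h1 h2
    have h3 : 1 - x ^ 2 = 0 := by
      rcases mul_eq_zero.1 h1 with h3 | h3
      · exact h3
      · have h4 : k * (1 - x ^ 2) = 0 := by linear_combination h2 + x * h3
        exact (mul_eq_zero.1 h4).resolve_left hk0.ne'
    have h4 : (x - 1) * (x + 1) = 0 := by linear_combination -h3
    rcases mul_eq_zero.1 h4 with h5 | h5
    · obtain rfl : x = 1 := by linarith
      exact absurd (by linarith) hEk
    · obtain rfl : x = -1 := by linarith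
      exact ⟨rfl, by linarith⟩
  rcases newton_dichotomy (F := fun x => k * (1 - x ^ 2) - 2 * x * (E + k * x))
    (f := fun x => (1 - x ^ 2) * (2 * (E + k * x))) (by fun_prop) (by fun_prop) hy hv hen
    (M := 1) (fun t => Real.abs_cos_le_one _)
    (fun x _ x' _ h1 h2 h3 h4 => (hz x h1 h2).1.trans (hz x' h3 h4).1.symm) with
    ⟨S, hS, hper⟩ | ⟨x, -, h1, h2, htop, hbot⟩
  · left
    -- The function cos φ and its derivative determine (sin φ, φ') up to a common sign. Changing
    -- that sign is a symmetry of the equations, so after two periods S the state returns.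
    refine ⟨hnc, 2 * S, by linarith, ?_⟩
    obtain ⟨p, hpdef⟩ : ∃ p : ℝ → ℝ × ℝ × ℝ,
      p = fun t => (Real.cos (φ t), Real.sin (φ t), φ' t) := ⟨_, rfl⟩
    have hcd : ContDiff ℝ 1
        (fun p : ℝ × ℝ × ℝ => (-p.2.1 * p.2.2, p.1 * p.2.2, -k * p.2.1)) := by fun_prop
    have hp : ∀ t, HasDerivAt p (-(p t).2.1 * (p t).2.2, (p t).1 * (p t).2.2, -k * (p t).2.1) t :=
      fun t => by
        rw [hpdef]
        exact (hφ t).cos.prodMk ((hφ t).sin.prodMk (hφ' t))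
    have hsign : p (0 + S) = p 0 ∨ p (0 + S) = ((p 0).1, -(p 0).2.1, -(p 0).2.2) := by
      obtain ⟨c1, c2⟩ := hper 0
      have h3 := hE (0 + S)
      have h4 := hE 0
      have h5 := Real.sin_sq (φ (0 + S))
      have h6 := Real.sin_sq (φ 0)
      rw [c1] at h3 h5
      rw [hpdef]
      rcases eq_or_eq_neg_of_sq (x := Real.sin (φ (0 + S))) (y := φ' (0 + S))
        (z := Real.sin (φ 0)) (w := φ' 0) (by linarith) (by linarith) with h7 | h7
      · exact Or.inl (Prod.ext c1 h7)
      · exact Or.inr (Prod.ext c1 h7)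
    have hshift := fun t => (hp (t + S)).comp_add_const t S
    have h2S : ∀ t, p (t + 2 * S) = p t := by
      intro t
      rw [show t + 2 * S = t + S + S by ring]
      rcases hsign with h0 | h0
      · have := fun t => congrFun (eq_of_hasDerivAt_of_contDiff hcd hshift hp (t₀ := 0) h0) t
        rw [this, this]
      · have := fun t => congrFun (eq_of_hasDerivAt_of_contDiff hcd hshift
          (δ := fun t => ((p t).1, -(p t).2.1, -(p t).2.2)) (fun t => by
            have h1 := (hasDerivAt_pi (φ := fun t (i : Fin 3) =>
              ![(p t).1, (p t).2.1, (p t).2.2] i) (φ' := fun i => ![-(p t).2.1 * (p t).2.2,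
              (p t).1 * (p t).2.2, -k * (p t).2.1] i)).1 (by
                rw [hpdef, hasDerivAt_pi]
                intro i
                fin_cases i
                · exact (hφ t).cos
                · exact (hφ t).sin
                · exact hφ' t)
            refine ((h1 0).prodMk ((h1 1).neg.prodMk (h1 2).neg)).congr_deriv ?_
            simp) (t₀ := 0) h0) t
        rw [this, this]
        simp
    intro t
    have h3 := h2S t
    have h4 : ∀ t, γ t = pendulumState a b e (p t) := fun t => by rw [hγ, hpdef]
    rw [h4, h4, h3]
  · right
    obtain ⟨rfl, rfl⟩ := hz x h1 h2
    have hlim : ∀ {l : Filter ℝ}, Tendsto (fun t => Real.cos (φ t)) l (𝓝 (-1)) →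
        Tendsto γ l (𝓝 (pendulumState a b e (-1, 0, 0))) := by
      intro l hl
      have hsqrt : ∀ g : ℝ → ℝ, Tendsto (fun t => g t ^ 2) l (𝓝 0) → Tendsto g l (𝓝 0) := by
        intro g hg
        have h4 := (Real.continuous_sqrt.tendsto 0).comp hg
        simp only [Function.comp_def, Real.sqrt_sq_eq_abs, Real.sqrt_zero] at h4
        exact (tendsto_zero_iff_abs_tendsto_zero g).2 h4
      have hs : Tendsto (fun t => Real.sin (φ t)) l (𝓝 0) := by
        refine hsqrt _ ?_
        simp only [Real.sin_sq]
        have := (hl.pow 2).const_sub 1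
        norm_num at this
        exact this
      have hv : Tendsto φ' l (𝓝 0) := by
        refine hsqrt _ ?_
        simp only [hE]
        have := ((hl.const_mul E).const_add E).const_mul 2
        simpa using this
      have := ((continuous_pendulumState a b e).tendsto (-1, 0, 0)).comp
        (hl.prodMk_nhds (hs.prodMk_nhds hv))
      exact this.congr fun t => (hγ t).symm
    have hmem : pendulumState a b e (-1, 0, 0) ∈ phaseSpace a b :=
      (isClosed_phaseSpace a b).mem_of_tendsto (hlim htop) (Eventually.of_forall hm.1)
    refine ⟨hnc, _, ⟨hmem, ?_⟩, hlim htop, hlim hbot⟩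
    rw [field_eq_zero_iff hb hab lam hmem]
    simp [pendulumState, om, al, be]

end KowalevskiGyrostat

end

noncomputable section

namespace KowalevskiGyrostat

/-! ### The stratum of rank one -/

section

variable {a b lam : ℝ} {s : State}

/-- At an equilibrium both differentials vanish and the rank is 0; elsewhere dH ≠ 0, so rank one
means proportionality. -/
theorem rankKH_eq_one_iff_field (hb : 0 < b) (hab : b < a) (hs : s ∈ phaseSpace a b) :
    rankKH lam s = 1 ↔ field lam s ≠ 0 ∧ ∃ c : ℝ, dres (K lam) s = c • dres H s := by
  by_cases h : field lam s = 0
  · have hH := (dres_H_eq_zero_iff hb hab lam hs).2 h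
    rw [rankKH_eq_zero lam hH (dres_K_eq_zero_of_field_eq_zero hb hab hs h)]
    simp [h]
  · rw [rankKH_eq_one_iff lam (mt (dres_H_eq_zero_iff hb hab lam hs).1 h)]
    simp [h]

/-- This is why G plays no role in the description of the stratum: it follows from the
classification of the points with dK = c dH, by checking both classes. -/
theorem exists_dres_G_of_dres_K {c : ℝ} (hb : 0 < b) (hab : b < a) (hlam : lam ≠ 0)
    (hs : s ∈ phaseSpace a b) (hK : dres (K lam) s = c • dres H s) :
    ∃ c : ℝ, dres (G a b lam) s = c • dres H s := by
  rcases planar_or_param hb hab hlam hs hK with h | ⟨σ, X, hσ, -, h⟩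
  · exact h.exists_dres_G hb hab hs lam
  · rw [h] at hs ⊢
    exact exists_dres_G_param hb hab hlam hσ hs

theorem rankJ_eq_one_iff_field (hb : 0 < b) (hab : b < a) (hlam : lam ≠ 0)
    (hs : s ∈ phaseSpace a b) :
    rankJ a b lam s = 1 ↔ field lam s ≠ 0 ∧ ∃ c : ℝ, dres (K lam) s = c • dres H s := by
  by_cases h : field lam s = 0
  · have hH := (dres_H_eq_zero_iff hb hab lam hs).2 h
    rw [rankJ_eq_zero a b lam hH (dres_K_eq_zero_of_field_eq_zero hb hab hs h)
      (dres_G_eq_zero_of_field_eq_zero hb hab hs h)]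
    simp [h]
  · rw [rankJ_eq_one_iff a b lam (mt (dres_H_eq_zero_iff hb hab lam hs).1 h)]
    exact ⟨fun h' => ⟨h, h'.1⟩,
      fun h' => ⟨h'.2, h'.2.elim fun c hc => exists_dres_G_of_dres_K hb hab hlam hs hc⟩⟩

theorem mem_stratum_one_iff (hb : 0 < b) (hab : b < a) (hlam : lam ≠ 0) :
    s ∈ stratum a b lam 1 ↔ s ∈ phaseSpace a b ∧ field lam s ≠ 0 ∧
      ∃ c : ℝ, dres (K lam) s = c • dres H s := by
  constructor
  · rintro ⟨⟨hs, -⟩, h⟩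
    exact ⟨hs, (rankJ_eq_one_iff_field hb hab hlam hs).1 h⟩
  · rintro ⟨hs, h⟩
    have h1 := (rankJ_eq_one_iff_field hb hab hlam hs).2 h
    exact ⟨⟨hs, by omega⟩, h1⟩

theorem stratum_one_eq (hb : 0 < b) (hab : b < a) (hlam : lam ≠ 0) :
    stratum a b lam 1 = {s ∈ phaseSpace a b | rankKH lam s = 1} := by
  ext s
  rw [mem_stratum_one_iff hb hab hlam]
  exact and_congr_right fun hs => (rankKH_eq_one_iff_field hb hab hs).symm

/-- With u = r²λ²σ/X, both the actual value of `planarH` and the value -`Pconst` / σ² are compatible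
with σ, X. By uniqueness they coincide, so the point satisfies the explicit formulas. -/
theorem exists_isSecondMotion_of_param {σ X o₁ o₂ : ℝ} (hb : 0 < b) (hab : b < a)
    (hlam : lam ≠ 0) (hσ : σ ≠ 0) (ho : o₁ ^ 2 + o₂ ^ 2 ≠ 0)
    (hs : param lam σ X o₁ o₂ ∈ phaseSpace a b) :
    ∃ u γ, IsSecondMotion a b lam σ u γ ∧ γ 0 = param lam σ X o₁ o₂ := by
  have hC := (param_mem_phaseSpace_iff hlam hσ).1 hs
  have hX := hC.ne_zero hb hab
  have hr := (r2_pos hb hab).ne'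
  have hQ := hC.quintic hb hab hlam
  have hu := hQ.ne_zero hb hab hlam hσ
  obtain ⟨u, hu'⟩ : ∃ u, u = r2 a b * lam ^ 2 * σ / X := ⟨_, rfl⟩
  have huX : r2 a b * lam ^ 2 * σ / u = X := by rw [hu']; field_simp
  rw [← hu'] at hQ hu
  have hC' := hQ.compatible hb hab hlam hσ
  rw [huX] at hC'
  have hT := hC.unique hb hab hC'
  have hw : 0 < o₁ ^ 2 + o₂ ^ 2 := by positivity
  have hF := secondFormulas_param hb hab hlam hσ hu hw (huX.symm ▸ hT)
  rw [huX] at hF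
  exact ⟨_, exists_isSecondMotion hb hab hlam hσ hQ hF⟩

theorem IsPendulumMotion.mem_stratum {γ : ℝ → State} (hb : 0 < b) (hab : b < a) (hlam : lam ≠ 0)
    (h : IsPendulumMotion a b γ) (hnc : Nonconstant γ) (t : ℝ) : γ t ∈ stratum a b lam 1 := by
  have hm := h.isMotion lam
  refine (mem_stratum_one_iff hb hab hlam).2 ⟨hm.1 t, fun h0 => ?_,
    0, (h.isPlanar t).dres_K hb hab (hm.1 t) lam⟩
  obtain ⟨t₁, t₂, hne⟩ := hnc
  exact hne ((hm.eq_of_field_eq_zero h0 t₁).trans (hm.eq_of_field_eq_zero h0 t₂).symm)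

theorem IsSecondMotion.mem_stratum {σ u : ℝ} {γ : ℝ → State} (hb : 0 < b) (hab : b < a)
    (hlam : lam ≠ 0) (h : IsSecondMotion a b lam σ u γ) (t : ℝ) : γ t ∈ stratum a b lam 1 := by
  obtain ⟨hm, hσ, hQ, w, q, w', hw'⟩ := h
  have hF := (hw' t).1
  obtain ⟨hw, hp, -⟩ := hF.eq_param hb hab hlam hσ hQ
  have hs := hm.1 t
  refine (mem_stratum_one_iff hb hab hlam).2 ⟨hs, fun h0 => ?_, 2 * σ, ?_⟩
  · obtain ⟨⟨h1, h2, -⟩, -⟩ := (field_eq_zero_iff hb hab lam hs).1 h0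
    have := hF.1
    rw [hw, h1, h2] at this
    norm_num at this
  · rw [hp] at hs ⊢
    exact dres_K_param hb hab hlam hσ hs

theorem stratum_one_eq_union (hb : 0 < b) (hab : b < a) (hlam : lam ≠ 0) :
    stratum a b lam 1
      = {s | ∃ γ, IsPendulumMotion a b γ ∧ Nonconstant γ ∧ s ∈ Set.range γ} ∪
        {s | ∃ σ u γ, IsSecondMotion a b lam σ u γ ∧ s ∈ Set.range γ} := by
  ext s
  constructor
  · intro h
    obtain ⟨hs, h0, c, hK⟩ := (mem_stratum_one_iff hb hab hlam).1 h
    rcases planar_or_param hb hab hlam hs hK with hp | ⟨σ, X, hσ, ho, hp⟩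
    · obtain ⟨γ, hγ, rfl⟩ := hp.exists_pendulumMotion hb hab hs
      exact Or.inl ⟨γ, hγ, (hγ.isMotion lam).nonconstant h0, 0, rfl⟩
    · rw [hp] at hs
      obtain ⟨u, γ, hγ, h1⟩ := exists_isSecondMotion_of_param hb hab hlam hσ ho hs
      exact Or.inr ⟨σ, u, γ, hγ, 0, h1.trans hp.symm⟩
  · rintro (⟨γ, hγ, hnc, t, rfl⟩ | ⟨σ, u, γ, hγ, t, rfl⟩)
    · exact hγ.mem_stratum hb hab hlam hnc t
    · exact hγ.mem_stratum hb hab hlam t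

end

end KowalevskiGyrostat

end

theorem proposition3 (a b lam : ℝ) (hb : 0 < b) (hab : b < a) (hlam : lam ≠ 0) :
    -- the stratum is defined by the condition on the differentials of `K` and `H`
    KowalevskiGyrostat.stratum a b lam 1
      = {s ∈ KowalevskiGyrostat.phaseSpace a b | KowalevskiGyrostat.rankKH lam s = 1} ∧
    -- it consists of the points of the trajectories of the two families
    KowalevskiGyrostat.stratum a b lam 1
      = {s | ∃ γ, KowalevskiGyrostat.IsPendulumMotion a b γ ∧
            KowalevskiGyrostat.Nonconstant γ ∧ s ∈ Set.range γ} ∪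
        {s | ∃ σ u γ, KowalevskiGyrostat.IsSecondMotion a b lam σ u γ ∧ s ∈ Set.range γ} ∧
    -- the pendulum motions are trajectories of the system
    (∀ γ, KowalevskiGyrostat.IsPendulumMotion a b γ → KowalevskiGyrostat.IsMotion a b lam γ) ∧
    -- every real point given by the formulas of the second family lies on such a trajectory
    (∀ σ u w q s, σ ≠ 0 → KowalevskiGyrostat.Quintic a b lam σ u →
      KowalevskiGyrostat.SecondFormulas a b lam σ u w q s →
      ∃ γ, KowalevskiGyrostat.IsSecondMotion a b lam σ u γ ∧ γ 0 = s) ∧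
    -- all these trajectories are periodic, apart from the separatrices
    (∀ γ, KowalevskiGyrostat.IsPendulumMotion a b γ → KowalevskiGyrostat.Nonconstant γ →
      KowalevskiGyrostat.IsPeriodicMotion γ ∨ KowalevskiGyrostat.IsSeparatrix a b lam γ) ∧
    (∀ σ u γ, KowalevskiGyrostat.IsSecondMotion a b lam σ u γ →
      KowalevskiGyrostat.IsPeriodicMotion γ ∨ KowalevskiGyrostat.IsSeparatrix a b lam γ) := by
  exact ⟨KowalevskiGyrostat.stratum_one_eq hb hab hlam,
    KowalevskiGyrostat.stratum_one_eq_union hb hab hlam,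
    fun _ h => h.isMotion lam,
    fun _ _ _ _ _ hσ hQ h => KowalevskiGyrostat.exists_isSecondMotion hb hab hlam hσ hQ h,
    fun _ h hnc => h.periodic_or_separatrix hb hab lam hnc,
    fun _ _ _ h => h.periodic_or_separatrix hb hab hlam⟩
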